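/- Let $D=\operatorname{diag}(d_1,\dots,d_n)$ be a real diagonal matrix with $d_i\ge 0$, of which exactly $p<n$ diagonal entries are zero ($p\ge 0$) and $n-p$ are positive. Let $I_+=\{i: d_i>0\}$ and $I_0=\{i: d_i=0\}$, and for $y\in\mathbb{R}^n$ let $y_{I_+}\in\mathbb{R}^{n-p}$, $y_{I_0}\in\mathbb{R}^{p}$ be the corresponding sub-vectors. Let $0\le t_0<\infty$. For $t>t_0$ put $$\kappa_+(t_0,y,t,z)=\kappa_{++}\big(t_0,y_{I_+},t,z_{I_+}\big)\,\kappa_0\big(t_0,y_{I_0},t,z_{I_0}\big),$$ where $\kappa_0$ is the heat kernel on $\mathbb{R}^p$, $$\kappa_0(t_0,x,t,w)=(4\pi(t-t_0))^{-p/2}\exp\Big(-\frac{|x-w|^2}{4(t-t_0)}\Big),$$ and, with $m=n-p$ and $D_+=\operatorname{diag}(d_i)_{i\in I_+}$, the kernel $\kappa_{++}$ on $\mathbb{R}^m$ is $$\kappa_{++}(t_0,x,t,w)=\frac{(\det M)^{1/4}}{(2\pi)^{m/2}\sqrt{\det\sinh(2(t-t_0)\sqrt{D_+})}}\exp\Big(-\tfrac12\begin{pmatrix}x^\top&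 w^\top\end{pmatrix}M\begin{pmatrix}x\\ w\end{pmatrix}\Big),$$ $$M=\begin{bmatrix}\sqrt{D_+}\coth(2(t-t_0)\sqrt{D_+}) & -\sqrt{D_+}\,\mathrm{csch}(2(t-t_0)\sqrt{D_+})\\ -\sqrt{D_+}\,\mathrm{csch}(2(t-t_0)\sqrt{D_+}) & \sqrt{D_+}\coth(2(t-t_0)\sqrt{D_+})\end{bmatrix},$$ functions of a diagonal matrix being applied to its diagonal entries. Consider the initial value problem $$\frac{\partial\eta}{\partial t}=\Delta_y\eta-(y^\top D y)\,\eta\quad (t>t_0,\ y\in\mathbb{R}^n),\qquad \eta(t_0,\cdot)=\eta_0,\tag{1}$$ where $\eta_0:\mathbb{R}^n\to\mathbb{R}$ is Lebesgue measurable and $\int_{\mathbb{R}^n}e^{-\frac12 z^\top\sqrt D z-\varepsilon|z|^2}|\eta_0(z)|\,dz<\infty$ for every $\varepsilon>0$ (for instance, $\eta_0$ bounded, or in some $L^q$, $1\le q\le\infty$). For $T>t_0$, a solution of (1) on $(t_0,T)$ is a function $u\in C^{1,2}((t_0,T)\times\mathbb{R}^n)$ that satisfies the equation pointwise and $\int_K|u(t,y)-\eta_0(y)|\,dy\to0$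 as $t\downarrow t_0$ for every compact $K\subset\mathbb{R}^n$; it has at most Gaussian growth if $\int_{t_0}^T\int_{\mathbb{R}^n}e^{-a|y|^2}|u(t,y)|\,dy\,dt<\infty$ for some $a>0$. Then, for all $t>t_0$ and $y\in\mathbb{R}^n$, the integral $$\eta(t,y)=\int_{\mathbb{R}^n}\kappa_+(t_0,y,t,z)\,\eta_0(z)\,dz$$ converges absolutely, and for every $T>t_0$ the function $\eta$ is the unique solution of (1) on $(t_0,T)$ with at most Gaussian growth. Moreover, if $\eta_0$ is continuous at $y_0$, then $\eta(t,y)\to\eta_0(y_0)$ as $(t,y)\to(t_0,y_0)$ with $t>t_0$. -/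

import Mathlib

open MeasureTheory Filter Topology Set

noncomputable section

namespace QuadraticSB

/-- The heat kernel `κ₀(s, x, t, y) = (4π(t-s))^{-n/2} exp(-|x-y|²/(4(t-s)))` on the Euclidean
space whose coordinates are indexed by `ι`, with `n = |ι|`. -/
def heatKernel {ι : Type*} [Fintype ι]
    (s : ℝ) (x : EuclideanSpace ℝ ι) (t : ℝ) (y : EuclideanSpace ℝ ι) : ℝ :=
  (4 * Real.pi * (t - s)) ^ (-(Fintype.card ι : ℝ) / 2) *
    Real.exp (-(‖x - y‖ ^ 2 / (4 * (t - s))))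

/-- `√D coth(2(t-t₀)√D)` for `D = diag d`. -/
def sqrtCoth {ι : Type*} [DecidableEq ι] (d : ι → ℝ) (t₀ t : ℝ) : Matrix ι ι ℝ :=
  Matrix.diagonal fun i =>
    √(d i) * (Real.cosh (2 * (t - t₀) * √(d i)) / Real.sinh (2 * (t - t₀) * √(d i)))

/-- `√D csch(2(t-t₀)√D)` for `D = diag d`. -/
def sqrtCsch {ι : Type*} [DecidableEq ι] (d : ι → ℝ) (t₀ t : ℝ) : Matrix ι ι ℝ :=
  Matrix.diagonal fun i => √(d i) * (1 / Real.sinh (2 * (t - t₀) * √(d i)))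

/-- `sinh(2(t-t₀)√D)` for `D = diag d`. -/
def sinhMat {ι : Type*} [DecidableEq ι] (d : ι → ℝ) (t₀ t : ℝ) : Matrix ι ι ℝ :=
  Matrix.diagonal fun i => Real.sinh (2 * (t - t₀) * √(d i))

/-- The `2n × 2n` block matrix `M_{t t₀}`. -/
def matM {ι : Type*} [DecidableEq ι] (d : ι → ℝ) (t₀ t : ℝ) : Matrix (ι ⊕ ι) (ι ⊕ ι) ℝ :=
  Matrix.fromBlocks (sqrtCoth d t₀ t) (-sqrtCsch d t₀ t) (-sqrtCsch d t₀ t) (sqrtCoth d t₀ t)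

/-- The kernel `κ₊₊(t₀, y, t, z)` for `D = diag d` with positive entries:
`det(M)^{1/4} / ((2π)^{n/2} √(det sinh(2(t-t₀)√D))) · exp(-½ (yᵀ zᵀ) M (y; z))`. -/
def kernelPosDef {ι : Type*} [Fintype ι] [DecidableEq ι] (d : ι → ℝ)
    (t₀ : ℝ) (y : EuclideanSpace ℝ ι) (t : ℝ) (z : EuclideanSpace ℝ ι) : ℝ :=
  (matM d t₀ t).det ^ (1 / 4 : ℝ) /
      ((2 * Real.pi) ^ ((Fintype.card ι : ℝ) / 2) * √(sinhMat d t₀ t).det) *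
    Real.exp (-(1 / 2) *
      ((Sum.elim (fun i => y i) fun i => z i) ⬝ᵥ
        (matM d t₀ t).mulVec (Sum.elim (fun i => y i) fun i => z i)))

/-- The sub-vector of `y` formed by the coordinates that satisfy `P`. -/
def subvec {n : ℕ} (P : Fin n → Prop) (y : EuclideanSpace ℝ (Fin n)) :
    EuclideanSpace ℝ {i : Fin n // P i} :=
  WithLp.toLp 2 fun i => y i.1

open Classical in
/-- The kernel `κ₊` for `D = diag d`, `d ≥ 0`: the product of `κ₊₊` on the coordinates with
`d i > 0` and of the heat kernel on the coordinates with `d i = 0`. -/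
def kernelSemiPosDef {n : ℕ} (d : Fin n → ℝ)
    (t₀ : ℝ) (y : EuclideanSpace ℝ (Fin n)) (t : ℝ) (z : EuclideanSpace ℝ (Fin n)) : ℝ :=
  kernelPosDef (fun i : {i : Fin n // 0 < d i} => d i.1) t₀
      (subvec (fun i => 0 < d i) y) t (subvec (fun i => 0 < d i) z) *
    heatKernel t₀ (subvec (fun i => d i = 0) y) t (subvec (fun i => d i = 0) z)

/-- `u` is a classical (`C^{1,2}`) solution on the time interval `(t₀, T)` of
`∂u/∂t = Δu - (yᵀ D y) u`, `D = diag d`, with initial value `η₀` at time `t₀`. The initial value is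
only a measurable function, so it is attained in the sense of `L¹_loc`. -/
structure IsIVPSolution {n : ℕ} (d : Fin n → ℝ) (t₀ T : ℝ)
    (η₀ : EuclideanSpace ℝ (Fin n) → ℝ) (u : ℝ → EuclideanSpace ℝ (Fin n) → ℝ) : Prop where
  contDiff_space : ∀ t ∈ Ioo t₀ T, ContDiff ℝ 2 (u t)
  continuousOn : ContinuousOn
    (fun p : ℝ × EuclideanSpace ℝ (Fin n) => u p.1 p.2) (Ioo t₀ T ×ˢ univ)
  continuousOn_fderiv : ContinuousOn
    (fun p : ℝ × EuclideanSpace ℝ (Fin n) => fderiv ℝ (u p.1) p.2) (Ioo t₀ T ×ˢ univ)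
  continuousOn_fderiv_fderiv : ContinuousOn
    (fun p : ℝ × EuclideanSpace ℝ (Fin n) => fderiv ℝ (fderiv ℝ (u p.1)) p.2) (Ioo t₀ T ×ˢ univ)
  -- continuity of `∂u/∂t` follows from the equation and the continuity of the other terms
  pde : ∀ t ∈ Ioo t₀ T, ∀ y : EuclideanSpace ℝ (Fin n),
    HasDerivAt (fun s => u s y)
      (Laplacian.laplacian (u t) y - (∑ i, d i * y i ^ 2) * u t y) t
  initial : ∀ K : Set (EuclideanSpace ℝ (Fin n)), IsCompact K →
    Tendsto (fun t => ∫⁻ y in K, ‖u t y - η₀ y‖ₑ) (𝓝[>] t₀) (𝓝 0)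

/-- At most Gaussian growth on `(t₀, T)`, in the integral sense:
`∫_{t₀}^T ∫ exp(-a|y|²) |u(t, y)| dy dt < ∞` for some `a > 0`. -/
def HasGaussianGrowth {n : ℕ} (t₀ T : ℝ) (u : ℝ → EuclideanSpace ℝ (Fin n) → ℝ) : Prop :=
  ∃ a : ℝ, 0 < a ∧
    IntegrableOn (fun p : ℝ × EuclideanSpace ℝ (Fin n) => Real.exp (-a * ‖p.2‖ ^ 2) * u p.1 p.2)
      (Ioo t₀ T ×ˢ univ)

/-- The class of initial data: `exp(-½ yᵀ√D y - ε|y|²) η₀` is Lebesgue integrable for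
every `ε > 0`. -/
def IsAdmissibleInitial {n : ℕ} (d : Fin n → ℝ) (η₀ : EuclideanSpace ℝ (Fin n) → ℝ) : Prop :=
  ∀ ε : ℝ, 0 < ε → Integrable fun z : EuclideanSpace ℝ (Fin n) =>
    Real.exp (-(1 / 2) * (∑ i, √(d i) * z i ^ 2) - ε * ‖z‖ ^ 2) * η₀ z

end QuadraticSB

end

noncomputable section

namespace QuadraticSB

/-! With `ω i = √(d i)` and `τ = t - t₀`, the kernel is a product of one-dimensional Mehler kernels
`(2πσ)^(-1/2) exp(-A(x² + y²)/2 + Bxy)`, where `σ = sinh(2ωτ)/ω`, `A = cosh(2ωτ)/σ`, `B = 1/σ`.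
Giving `σ` its limit `2τ` at `ω = 0` makes the heat kernel a special case, so both kinds of
coordinates are treated together (`kernelSemiPosDef_eq`).

Existence. As a function of `z` the kernel is a Gaussian exponential family whose parameters depend
smoothly on `(τ, y)`. Since `A > ω`, these parameters lie in an open set on which all moments of
admissible data converge, so the integral is smooth and its derivatives are moments
(`contDiffOn_expMoment`). The equation then reduces to `A' = -2B²`, `B' = -2AB` and `A² - B² = ω²`
(`IsAdmissible.hasDerivAt_evolve`).

Initial values. The kernel concentrates on the diagonal and its mass tends to 1, which gives
convergence at continuity points (`IsAdmissible.tendsto_evolve`). A bound in a Gaussian-weighted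
`L¹` space (`exists_lintegral_evolve_le`) and density of continuous compactly supported functions
give `L¹_loc` convergence for all admissible data; the same bound gives Gaussian growth.

Uniqueness. Let `W` be the difference of two solutions. Pairing `W(s, ·)` with the backward kernel
with pole `(β, x)` and a cutoff at radius `R`, Green's identity leaves only an error on `‖y‖ ≥ R`
containing `W` but not its gradient. For short times the kernel and its gradient there are below
`exp(-a‖y‖²)` for the rate `a` of `W`, so the error is a tail of a convergent integral and vanishes
as `R → ∞`. The admissible time length depends only on `a` and `ω`, so finitely many steps reach any
time (`IsIVPSolution.eq_zero`). -/

/-- The function `sinh(2ωτ)/ω`, with value `2τ` for `ω = 0`. -/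
def width (ω τ : ℝ) : ℝ := if ω = 0 then 2 * τ else Real.sinh (2 * ω * τ) / ω

/-- The coefficient `ω coth(2ωτ)` of the squares in the exponent of the Mehler kernel. -/
def diagCoeff (ω τ : ℝ) : ℝ := Real.cosh (2 * ω * τ) / width ω τ

/-- The coefficient `ω csch(2ωτ)` of the product in the exponent of the Mehler kernel. -/
def crossCoeff (ω τ : ℝ) : ℝ := (width ω τ)⁻¹

/-- The one-dimensional Mehler kernel for `∂ₜ = ∂ₓ² - ω²x²`. -/
def mehler (ω τ x y : ℝ) : ℝ :=
  (√(2 * Real.pi * width ω τ))⁻¹ *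
    Real.exp (-(diagCoeff ω τ / 2) * (x ^ 2 + y ^ 2) + crossCoeff ω τ * x * y)

/-- The product of one-dimensional Mehler kernels. -/
def mehlerProd {ι : Type*} [Fintype ι] (ω : ι → ℝ) (τ : ℝ) (y z : EuclideanSpace ℝ ι) : ℝ :=
  ∏ i, mehler (ω i) τ (y i) (z i)

/-! ### Differential identities and short-time bounds for the one-dimensional kernel. -/

section OneDim

variable {ω τ : ℝ}

lemma width_pos (ω : ℝ) (hτ : 0 < τ) : 0 < width ω τ := by
  unfold width
  split_ifs with h
  · positivity
  · rcases lt_or_gt_of_ne h with h | h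
    · exact div_pos_of_neg_of_neg (Real.sinh_neg_iff.2 (by nlinarith)) h
    · exact div_pos (Real.sinh_pos_iff.2 (by positivity)) h

lemma width_zero (ω : ℝ) : width ω 0 = 0 := by
  unfold width
  split_ifs <;> simp

lemma hasDerivAt_width (ω τ : ℝ) : HasDerivAt (width ω) (2 * Real.cosh (2 * ω * τ)) τ := by
  unfold width
  by_cases h : ω = 0
  · subst h
    simpa using (hasDerivAt_id τ).const_mul 2
  · simp only [h, if_false]
    have h1 : HasDerivAt (fun τ : ℝ => 2 * ω * τ) (2 * ω) τ := by
      simpa using (hasDerivAt_id τ).const_mul (2 * ω)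
    exact ((h1.sinh).div_const ω).congr_deriv (by field_simp)

lemma contDiff_width (ω : ℝ) {k : WithTop ℕ∞} : ContDiff ℝ k (width ω) := by
  unfold width
  by_cases h : ω = 0
  · simp only [h, if_true]
    fun_prop
  · simp only [h, if_false]
    exact (Real.contDiff_sinh.comp (by fun_prop)).div_const _

lemma hasDerivAt_cosh_two_mul (ω τ : ℝ) :
    HasDerivAt (fun τ => Real.cosh (2 * ω * τ)) (2 * ω ^ 2 * width ω τ) τ := by
  have h1 : HasDerivAt (fun τ : ℝ => 2 * ω * τ) (2 * ω) τ := by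
    simpa using (hasDerivAt_id τ).const_mul (2 * ω)
  refine h1.cosh.congr_deriv ?_
  unfold width
  split_ifs with h
  · simp [h]
  · field_simp

lemma cosh_sq_eq_one_add (ω τ : ℝ) :
    Real.cosh (2 * ω * τ) ^ 2 = 1 + ω ^ 2 * width ω τ ^ 2 := by
  rw [Real.cosh_sq]
  unfold width
  split_ifs with h
  · simp [h]
  · field_simp
    ring

lemma two_mul_le_width (ω : ℝ) (hτ : 0 ≤ τ) : 2 * τ ≤ width ω τ := by
  have h := image_le_of_deriv_right_le_deriv_boundary (f := fun t : ℝ => 2 * t)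
    (f' := fun _ => 2) (a := 0) (b := τ) (B := width ω) (B' := fun t => 2 * Real.cosh (2 * ω * t))
    (by fun_prop) (fun x _ => by
      simpa using ((hasDerivAt_id x).const_mul (2 : ℝ)).hasDerivWithinAt)
    (by simp [width_zero])
    (contDiff_width ω (k := 1)).continuous.continuousOn
    (fun x _ => (hasDerivAt_width ω x).hasDerivWithinAt)
    (fun x _ => by have := Real.one_le_cosh (2 * ω * x); linarith)
  exact h ⟨hτ, le_rfl⟩

/-- The slope of `width ω` at 0 is 2, so every slope above 2 would do. -/
lemma eventually_width_le (ω : ℝ) : ∀ᶠ τ in 𝓝[>] (0 : ℝ), width ω τ ≤ 4 * τ := by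
  have h := (hasDerivAt_width ω 0).isLittleO.def (c := 2) (by norm_num)
  filter_upwards [h.filter_mono nhdsWithin_le_nhds, self_mem_nhdsWithin] with τ h1 h2
  simp only [width_zero, sub_zero, smul_eq_mul, mul_zero, Real.cosh_zero, mul_one,
    Real.norm_eq_abs, abs_of_pos (show (0 : ℝ) < τ from h2)] at h1
  linarith [(abs_le.1 h1).2]

lemma crossCoeff_pos (ω : ℝ) (hτ : 0 < τ) : 0 < crossCoeff ω τ := inv_pos.2 (width_pos ω hτ)

lemma crossCoeff_le_diagCoeff (ω : ℝ) (hτ : 0 < τ) : crossCoeff ω τ ≤ diagCoeff ω τ := by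
  unfold crossCoeff diagCoeff
  rw [inv_eq_one_div]
  exact div_le_div_of_nonneg_right (Real.one_le_cosh _) (width_pos ω hτ).le

/-- This is `coth² - csch² = 1`, and the identity through which the potential enters the
differential equation. -/
lemma crossCoeff_sq (ω : ℝ) (hτ : 0 < τ) : crossCoeff ω τ ^ 2 = diagCoeff ω τ ^ 2 - ω ^ 2 := by
  have := (width_pos ω hτ).ne'
  unfold crossCoeff diagCoeff
  field_simp
  linarith [cosh_sq_eq_one_add ω τ]

/-- The strict inequality leaves room for the `ε` in the definition of admissible data, at every
positive time. -/
lemma lt_diagCoeff (ω : ℝ) (hτ : 0 < τ) : ω < diagCoeff ω τ := by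
  have h1 := crossCoeff_sq ω hτ
  have h2 := crossCoeff_pos ω hτ
  have h3 := crossCoeff_le_diagCoeff ω hτ
  nlinarith

lemma hasDerivAt_diagCoeff (ω : ℝ) (hτ : 0 < τ) :
    HasDerivAt (diagCoeff ω) (-2 * crossCoeff ω τ ^ 2) τ := by
  have := (width_pos ω hτ).ne'
  refine ((hasDerivAt_cosh_two_mul ω τ).div (hasDerivAt_width ω τ) this).congr_deriv ?_
  unfold crossCoeff
  field_simp
  linarith [cosh_sq_eq_one_add ω τ]

lemma hasDerivAt_crossCoeff (ω : ℝ) (hτ : 0 < τ) :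
    HasDerivAt (crossCoeff ω) (-2 * diagCoeff ω τ * crossCoeff ω τ) τ := by
  have := (width_pos ω hτ).ne'
  refine ((hasDerivAt_width ω τ).inv this).congr_deriv ?_
  unfold crossCoeff diagCoeff
  field_simp

lemma contDiffAt_diagCoeff (ω : ℝ) (hτ : 0 < τ) {k : WithTop ℕ∞} :
    ContDiffAt ℝ k (diagCoeff ω) τ :=
  ((Real.contDiff_cosh.comp (by fun_prop)).contDiffAt).div (contDiff_width ω).contDiffAt
    (width_pos ω hτ).ne'

lemma contDiffAt_crossCoeff (ω : ℝ) (hτ : 0 < τ) {k : WithTop ℕ∞} :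
    ContDiffAt ℝ k (crossCoeff ω) τ :=
  (contDiff_width ω).contDiffAt.inv (width_pos ω hτ).ne'

lemma mehler_pos (ω : ℝ) (hτ : 0 < τ) (x y : ℝ) : 0 < mehler ω τ x y := by
  have := width_pos ω hτ
  unfold mehler
  positivity

lemma mehler_symm (ω τ x y : ℝ) : mehler ω τ x y = mehler ω τ y x := by
  unfold mehler
  congr 2
  ring

/-- Because `B ≤ A`, the exponent is at most `-B(x - y)²/2`, and `B` is at least `1/(4τ)`. -/
lemma mehler_le (ω : ℝ) (hτ : 0 < τ) (hτ1 : τ ≤ 1) (hw : width ω τ ≤ 4 * τ) (x y : ℝ) :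
    mehler ω τ x y ≤ τ⁻¹ * Real.exp (-((x - y) ^ 2 / (8 * τ))) := by
  have hσ := width_pos ω hτ
  have h2 := two_mul_le_width ω hτ.le
  have hBA := crossCoeff_le_diagCoeff ω hτ
  have hB : (4 * τ)⁻¹ ≤ crossCoeff ω τ := inv_anti₀ hσ hw
  have hB' : (x - y) ^ 2 / (8 * τ) ≤ crossCoeff ω τ / 2 * (x - y) ^ 2 := by
    have : (x - y) ^ 2 / (8 * τ) = (4 * τ)⁻¹ / 2 * (x - y) ^ 2 := by field_simp; ring
    rw [this]
    gcongr
  unfold mehler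
  gcongr
  -- The true order of the prefactor is `τ^(-1/2)`; for `τ ≤ 1` it is weakened to `τ⁻¹` to avoid
  -- roots.
  · apply Real.le_sqrt_of_sq_le
    nlinarith [Real.pi_gt_three]
  · nlinarith [sq_nonneg x, sq_nonneg y]

end OneDim

/-! ### Short-time bounds for the product kernel. -/

section Prod

variable {ι : Type*} [Fintype ι] {τ : ℝ}

lemma mehlerProd_pos (ω : ι → ℝ) (hτ : 0 < τ) (y z : EuclideanSpace ℝ ι) :
    0 < mehlerProd ω τ y z := Finset.prod_pos fun _ _ => mehler_pos _ hτ _ _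

lemma mehlerProd_symm (ω : ι → ℝ) (τ : ℝ) (y z : EuclideanSpace ℝ ι) :
    mehlerProd ω τ y z = mehlerProd ω τ z y :=
  Finset.prod_congr rfl fun _ _ => mehler_symm _ _ _ _

lemma eventually_mehlerProd_le (ω : ι → ℝ) : ∀ᶠ τ in 𝓝[>] (0 : ℝ), ∀ y z : EuclideanSpace ℝ ι,
    mehlerProd ω τ y z ≤ τ⁻¹ ^ Fintype.card ι * Real.exp (-(‖y - z‖ ^ 2 / (8 * τ))) := by
  have h1 : ∀ᶠ τ in 𝓝[>] (0 : ℝ), τ ≤ 1 :=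
    nhdsWithin_le_nhds (eventually_le_nhds (by norm_num))
  filter_upwards [eventually_all.2 fun i => eventually_width_le (ω i), h1, self_mem_nhdsWithin]
    with τ hw h1 h0 y z
  have : τ⁻¹ ^ Fintype.card ι * Real.exp (-(‖y - z‖ ^ 2 / (8 * τ))) =
      ∏ i, (τ⁻¹ * Real.exp (-((y i - z i) ^ 2 / (8 * τ)))) := by
    rw [Finset.prod_mul_distrib, Finset.prod_const, Finset.card_univ, ← Real.exp_sum,
      EuclideanSpace.norm_sq_eq, Finset.sum_neg_distrib, Finset.sum_div]
    simp
  rw [this]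
  exact Finset.prod_le_prod (fun _ _ => (mehler_pos _ h0 _ _).le)
    fun i _ => mehler_le _ h0 h1 (hw i) _ _

/-- Away from the diagonal, the kernel is smaller than any Gaussian for short times. -/
lemma eventually_mehlerProd_le_of_far (ω : ι → ℝ) {c : ℝ} (hc : 0 < c) (Λ : ℝ) :
    ∀ᶠ τ in 𝓝[>] (0 : ℝ), ∀ y z : EuclideanSpace ℝ ι, c ≤ ‖y - z‖ → c * ‖z‖ ≤ ‖y - z‖ →
      mehlerProd ω τ y z ≤ τ ^ 2 * Real.exp (-Λ * ‖z‖ ^ 2) := by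
  have hlim : Tendsto (fun τ : ℝ => (τ⁻¹) ^ (Fintype.card ι + 2) *
      Real.exp (-(c ^ 2 / 16) * τ⁻¹)) (𝓝[>] 0) (𝓝 0) := by
    have h2 : Tendsto (fun x : ℝ => x ^ (Fintype.card ι + 2) * Real.exp (-(c ^ 2 / 16) * x)) atTop
        (𝓝 0) := by
      have := tendsto_rpow_mul_exp_neg_mul_atTop_nhds_zero ((Fintype.card ι + 2 : ℕ) : ℝ)
        (c ^ 2 / 16) (by positivity)
      simpa only [Real.rpow_natCast] using this
    exact h2.comp tendsto_inv_nhdsGT_zero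
  have hΛ : ∀ᶠ τ in 𝓝[>] (0 : ℝ), Λ ≤ c ^ 2 / 16 * τ⁻¹ :=
    (tendsto_inv_nhdsGT_zero.const_mul_atTop (by positivity)).eventually_ge_atTop Λ
  filter_upwards [eventually_mehlerProd_le ω, hlim.eventually_le_const one_pos, hΛ,
    self_mem_nhdsWithin] with τ hK h1 hΛ h0 y z hyz hyz'
  have h0 : 0 < τ := h0
  refine (hK y z).trans ?_
  -- The average of the squares of the two lower bounds. Its constant part gives a factor
  -- `exp(-c²/(16τ))` that beats all powers of `τ⁻¹`; its quadratic part gives a rate that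
  -- eventually exceeds `Λ`.
  have hsq : c ^ 2 * (1 + ‖z‖ ^ 2) / 2 ≤ ‖y - z‖ ^ 2 := by
    have := pow_le_pow_left₀ hc.le hyz 2
    have := pow_le_pow_left₀ (by positivity) hyz' 2
    nlinarith
  have hexp : -(‖y - z‖ ^ 2 / (8 * τ)) ≤ -(c ^ 2 / 16) * τ⁻¹ + -Λ * ‖z‖ ^ 2 := by
    have h3 : c ^ 2 * (1 + ‖z‖ ^ 2) / 2 / (8 * τ) ≤ ‖y - z‖ ^ 2 / (8 * τ) := by gcongr
    have h4 : c ^ 2 * (1 + ‖z‖ ^ 2) / 2 / (8 * τ) =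
      c ^ 2 / 16 * τ⁻¹ + (c ^ 2 / 16 * τ⁻¹) * ‖z‖ ^ 2 := by field_simp; ring
    have h5 := mul_le_mul_of_nonneg_right hΛ (sq_nonneg ‖z‖)
    linarith
  calc τ⁻¹ ^ Fintype.card ι * Real.exp (-(‖y - z‖ ^ 2 / (8 * τ)))
      ≤ τ⁻¹ ^ Fintype.card ι * (Real.exp (-(c ^ 2 / 16) * τ⁻¹) * Real.exp (-Λ * ‖z‖ ^ 2)) := by
        rw [← Real.exp_add]; gcongr
    _ = τ ^ 2 * (τ⁻¹ ^ (Fintype.card ι + 2) * Real.exp (-(c ^ 2 / 16) * τ⁻¹)) *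
          Real.exp (-Λ * ‖z‖ ^ 2) := by
        rw [pow_add]; field_simp
    _ ≤ τ ^ 2 * 1 * Real.exp (-Λ * ‖z‖ ^ 2) := by gcongr
    _ = _ := by ring

end Prod

/-! ### Identification of the block-matrix kernel with the product of Mehler kernels. -/

section Kernel

/-- By the Schur complement of the diagonal blocks, each coordinate contributes `d (coth² - csch²) =
d`, so the time dependence cancels. -/
lemma det_matM {ι : Type*} [Fintype ι] [DecidableEq ι] (d : ι → ℝ) (hd : ∀ i, 0 < d i)
    {t₀ t : ℝ} (ht : t₀ < t) : (matM d t₀ t).det = ∏ i, d i := by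
  have hs : ∀ i, 0 < Real.sinh (2 * (t - t₀) * √(d i)) := fun i =>
    Real.sinh_pos_iff.2 (mul_pos (by linarith) (Real.sqrt_pos.2 (hd i)))
  have hc : ∀ i, 0 < √(d i) * (Real.cosh (2 * (t - t₀) * √(d i)) /
      Real.sinh (2 * (t - t₀) * √(d i))) := fun i =>
    mul_pos (Real.sqrt_pos.2 (hd i)) (div_pos (Real.cosh_pos _) (hs i))
  have hu : IsUnit (sqrtCoth d t₀ t) := by
    rw [Matrix.isUnit_iff_isUnit_det, sqrtCoth, Matrix.det_diagonal, isUnit_iff_ne_zero]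
    exact Finset.prod_ne_zero_iff.2 fun i _ => (hc i).ne'
  let _ := hu.invertible
  rw [matM, Matrix.det_fromBlocks₁₁, Matrix.invOf_eq_nonsing_inv]
  unfold sqrtCoth sqrtCsch
  rw [Matrix.inv_diagonal, neg_mul, neg_mul, mul_neg, neg_neg, Matrix.diagonal_mul_diagonal,
    Matrix.diagonal_mul_diagonal, Matrix.diagonal_sub, Matrix.det_diagonal, Matrix.det_diagonal,
    ← Finset.prod_mul_distrib]
  refine Finset.prod_congr rfl fun i _ => ?_
  -- The inverse in the ring of functions is the pointwise one, by uniqueness of inverses.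
  have hinv : Ring.inverse (fun i => √(d i) * (Real.cosh (2 * (t - t₀) * √(d i)) /
      Real.sinh (2 * (t - t₀) * √(d i)))) = fun i => (√(d i) * (Real.cosh (2 * (t - t₀) * √(d i)) /
      Real.sinh (2 * (t - t₀) * √(d i))))⁻¹ := by
    refine eq_comm.1 (left_inv_eq_right_inv (a := fun i => √(d i) *
      (Real.cosh (2 * (t - t₀) * √(d i)) / Real.sinh (2 * (t - t₀) * √(d i)))) ?_
        (Ring.mul_inverse_cancel _ (Pi.isUnit_iff.2 fun i => (hc i).ne'.isUnit)))
    ext i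
    exact inv_mul_cancel₀ (hc i).ne'
  rw [hinv]
  have h1 := (hs i).ne'
  beta_reduce
  generalize 2 * (t - t₀) * √(d i) = x at h1 ⊢
  have h2 := (Real.cosh_pos x).ne'
  have h3 := (Real.sqrt_pos.2 (hd i)).ne'
  have h4 := Real.cosh_sq x
  have h5 := Real.sq_sqrt (hd i).le
  field_simp
  rw [h4, h5]
  field_simp
  ring

/-- Coordinatewise the prefactors agree because `d^(1/4) / √(sinh) = (sinh / √d)^(-1/2)`. -/
lemma kernelPosDef_eq {ι : Type*} [Fintype ι] [DecidableEq ι] (d : ι → ℝ) (hd : ∀ i, 0 < d i)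
    {t₀ t : ℝ} (ht : t₀ < t) (y z : EuclideanSpace ℝ ι) :
    kernelPosDef d t₀ y t z = mehlerProd (fun i => √(d i)) (t - t₀) y z := by
  have hsq : ∀ i, 0 < √(d i) := fun i => Real.sqrt_pos.2 (hd i)
  have hs : ∀ i, 0 < Real.sinh (2 * (t - t₀) * √(d i)) := fun i =>
    Real.sinh_pos_iff.2 (mul_pos (by linarith) (hsq i))
  have hmul : ∀ i, 2 * √(d i) * (t - t₀) = 2 * (t - t₀) * √(d i) := fun i => by ring
  have hw : ∀ i, width (√(d i)) (t - t₀) = Real.sinh (2 * (t - t₀) * √(d i)) / √(d i) := fun i => by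
    rw [width, if_neg (hsq i).ne', hmul]
  unfold kernelPosDef mehlerProd mehler
  rw [Finset.prod_mul_distrib, ← Real.exp_sum]
  congr 1
  · rw [det_matM d hd ht, sinhMat, Matrix.det_diagonal,
      Real.sqrt_eq_rpow (∏ i, _), ← Real.finsetProd_rpow _ _ fun i _ => (hd i).le,
      ← Real.finsetProd_rpow _ _ fun i _ => (hs i).le]
    have : (2 * Real.pi) ^ ((Fintype.card ι : ℝ) / 2) = ∏ _i : ι, √(2 * Real.pi) := by
      rw [Finset.prod_const, Finset.card_univ, Real.sqrt_eq_rpow, ← Real.rpow_natCast,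
        ← Real.rpow_mul (by positivity)]
      congr 1
      ring
    rw [this, ← Finset.prod_mul_distrib, ← Finset.prod_div_distrib]
    refine Finset.prod_congr rfl fun i _ => ?_
    rw [hw, ← Real.sqrt_eq_rpow]
    have h1 : d i ^ (1 / 4 : ℝ) = √(√(d i)) := by
      rw [Real.sqrt_eq_rpow, Real.sqrt_eq_rpow, ← Real.rpow_mul (hd i).le]
      norm_num
    rw [h1, ← mul_div_assoc, Real.sqrt_div (by have := hs i; positivity), inv_div,
      ← Real.sqrt_mul (by positivity)]
  · congr 1
    rw [matM, Matrix.fromBlocks_mulVec]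
    simp only [Sum.elim_comp_inl, Sum.elim_comp_inr, sqrtCoth, sqrtCsch, Matrix.neg_mulVec]
    rw [dotProduct, Fintype.sum_sum_type, ← Finset.sum_add_distrib, Finset.mul_sum]
    refine Finset.sum_congr rfl fun i _ => ?_
    have h1 := (hs i).ne'
    have h3 := (hsq i).ne'
    simp only [Sum.elim_inl, Sum.elim_inr, Pi.add_apply, Pi.neg_apply, Matrix.mulVec_diagonal,
      diagCoeff, crossCoeff, hw, hmul]
    field_simp
    ring

lemma heatKernel_eq {ι : Type*} [Fintype ι] {t₀ t : ℝ} (ht : t₀ < t) (y z : EuclideanSpace ℝ ι) :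
    heatKernel t₀ y t z = mehlerProd (fun _ => 0) (t - t₀) y z := by
  have h0 : 0 < t - t₀ := sub_pos.2 ht
  unfold heatKernel mehlerProd mehler
  rw [Finset.prod_mul_distrib, ← Real.exp_sum]
  congr 1
  · rw [Finset.prod_const, Finset.card_univ, Real.sqrt_eq_rpow, ← Real.rpow_natCast,
      ← Real.rpow_neg (by simp [width]; positivity), ← Real.rpow_mul (by simp [width]; positivity)]
    simp only [width, if_true]
    congr 1 <;> ring
  · congr 1
    rw [EuclideanSpace.norm_sq_eq, Finset.sum_div, ← Finset.sum_neg_distrib]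
    refine Finset.sum_congr rfl fun i _ => ?_
    simp only [PiLp.sub_apply, Real.norm_eq_abs, sq_abs, diagCoeff, crossCoeff, width, if_true,
      mul_zero, zero_mul, Real.cosh_zero]
    field_simp
    ring

lemma kernelSemiPosDef_eq {n : ℕ} (d : Fin n → ℝ) (hd : ∀ i, 0 ≤ d i)
    {t₀ t : ℝ} (ht : t₀ < t) (y z : EuclideanSpace ℝ (Fin n)) :
    kernelSemiPosDef d t₀ y t z = mehlerProd (fun i => √(d i)) (t - t₀) y z := by
  classical
  rw [kernelSemiPosDef, heatKernel_eq ht]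
  rw [kernelPosDef_eq _ (fun i => i.2) ht, mehlerProd, mehlerProd, mehlerProd,
    ← Fintype.prod_subtype_mul_prod_subtype (fun i => 0 < d i)]
  congr 1
  -- Since `d ≥ 0`, the coordinates with `¬ 0 < d i` are those with `d i = 0`, where `width` takes
  -- its heat kernel value.
  refine Fintype.prod_equiv (Equiv.subtypeEquivRight fun i => ?_) _ _ fun i => ?_
  · exact ⟨fun h => by simp [h], fun h => le_antisymm (not_lt.1 h) (hd i)⟩
  · simp [subvec, i.2]

end Kernel

/-! ### Gaussian integrals against the kernel. -/

section OneDim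

variable {a τ : ℝ}

/-- Completing the square in `y`; the remaining coefficient of `z²` simplifies by `cosh² - ω²σ² =
1`. -/
lemma mehler_mul_exp_eq (ω : ℝ) (ha : 0 ≤ a) (hτ : 0 < τ) (y z : ℝ) :
    mehler ω τ y z * Real.exp (-a * y ^ 2) =
      (√(2 * Real.pi * width ω τ))⁻¹ *
        Real.exp (-((ω ^ 2 * width ω τ + 2 * a * Real.cosh (2 * ω * τ)) /
          (2 * (Real.cosh (2 * ω * τ) + 2 * a * width ω τ))) * z ^ 2) *
        Real.exp (-(diagCoeff ω τ / 2 + a) *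
          (y - z / (Real.cosh (2 * ω * τ) + 2 * a * width ω τ)) ^ 2) := by
  have hσ := width_pos ω hτ
  have hc := Real.cosh_pos (2 * ω * τ)
  have hs := cosh_sq_eq_one_add ω τ
  have hca : 0 < Real.cosh (2 * ω * τ) + 2 * a * width ω τ := by positivity
  rw [mehler, mul_assoc _ (Real.exp _) (Real.exp _), mul_assoc _ (Real.exp _) (Real.exp _),
    ← Real.exp_add, ← Real.exp_add]
  congr 2
  unfold diagCoeff crossCoeff
  field_simp
  linear_combination (-z ^ 2) * hs

lemma integrable_mehler_mul_exp (ω : ℝ) (ha : 0 ≤ a) (hτ : 0 < τ) (z : ℝ) :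
    Integrable fun y => mehler ω τ y z * Real.exp (-a * y ^ 2) := by
  have hσ := width_pos ω hτ
  simp_rw [mehler_mul_exp_eq ω ha hτ]
  have hb : 0 < diagCoeff ω τ / 2 + a := by
    have := Real.cosh_pos (2 * ω * τ)
    unfold diagCoeff
    positivity
  exact ((integrable_exp_neg_mul_sq hb).comp_sub_right _).const_mul _

lemma integral_mehler_mul_exp (ω : ℝ) (ha : 0 ≤ a) (hτ : 0 < τ) (z : ℝ) :
    ∫ y, mehler ω τ y z * Real.exp (-a * y ^ 2) =
      (√(Real.cosh (2 * ω * τ) + 2 * a * width ω τ))⁻¹ *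
        Real.exp (-((ω ^ 2 * width ω τ + 2 * a * Real.cosh (2 * ω * τ)) /
          (2 * (Real.cosh (2 * ω * τ) + 2 * a * width ω τ))) * z ^ 2) := by
  have hσ := width_pos ω hτ
  have hc := Real.cosh_pos (2 * ω * τ)
  have hca : 0 < Real.cosh (2 * ω * τ) + 2 * a * width ω τ := by positivity
  simp_rw [mehler_mul_exp_eq ω ha hτ]
  rw [integral_const_mul, integral_sub_right_eq_self
    (fun y => Real.exp (-(diagCoeff ω τ / 2 + a) * y ^ 2)), integral_gaussian, mul_right_comm]
  congr 1
  rw [← Real.sqrt_inv, ← Real.sqrt_inv, ← Real.sqrt_mul (by positivity)]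
  congr 1
  unfold diagCoeff
  have := Real.pi_pos
  field_simp

/-- The rate on the right exceeds `ω/2` by exactly `(2a - ω) exp(-2ωτ) / (2(cosh(2ωτ) + 2aσ))`,
which is bounded below by a positive constant for bounded `τ`. Hence a single `ε` serves all times
up to `T`. -/
lemma eventually_le_gaussian_rate {ω : ℝ} (hω : 0 ≤ ω) (ha : ω < 2 * a) (T : ℝ) :
    ∀ᶠ ε in 𝓝[>] (0 : ℝ), ∀ τ ∈ Ioc 0 T,
      ω / 2 + ε ≤ (ω ^ 2 * width ω τ + 2 * a * Real.cosh (2 * ω * τ)) /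
          (2 * (Real.cosh (2 * ω * τ) + 2 * a * width ω τ)) := by
  have hM : ∃ M : ℝ, ∀ τ ∈ Icc 0 T, Real.cosh (2 * ω * τ) + 2 * a * width ω τ ≤ M := by
    have hcont : Continuous fun τ => Real.cosh (2 * ω * τ) + 2 * a * width ω τ :=
      (Real.continuous_cosh.comp (by fun_prop)).add
        ((contDiff_width ω (k := 1)).continuous.const_mul _)
    obtain ⟨M, hM⟩ := isCompact_Icc.bddAbove_image (hcont.continuousOn (s := Icc 0 T))
    exact ⟨M, fun τ hτ => hM ⟨τ, hτ, rfl⟩⟩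
  obtain ⟨M, hM⟩ := hM
  have hpos : 0 < (2 * a - ω) * Real.exp (-(2 * ω * T)) / (2 * max M 1) := by
    have : 0 < max M 1 := by positivity
    have : 0 < 2 * a - ω := by linarith
    positivity
  filter_upwards [nhdsWithin_le_nhds (eventually_le_nhds hpos)] with ε hε τ hτ
  have hσ := width_pos ω hτ.1
  have hc := Real.cosh_pos (2 * ω * τ)
  have ha0 : 0 < a := by linarith
  have hca : 0 < Real.cosh (2 * ω * τ) + 2 * a * width ω τ := by positivity
  have hexp : Real.cosh (2 * ω * τ) - ω * width ω τ = Real.exp (-(2 * ω * τ)) := by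
    rw [← Real.cosh_sub_sinh]
    unfold width
    split_ifs with h
    · simp [h]
    · field_simp
  have h1 : (ω ^ 2 * width ω τ + 2 * a * Real.cosh (2 * ω * τ)) /
      (2 * (Real.cosh (2 * ω * τ) + 2 * a * width ω τ)) - ω / 2 =
      (2 * a - ω) * Real.exp (-(2 * ω * τ)) /
        (2 * (Real.cosh (2 * ω * τ) + 2 * a * width ω τ)) := by
    rw [← hexp]
    field_simp
    ring
  have h2 : (2 * a - ω) * Real.exp (-(2 * ω * T)) / (2 * max M 1) ≤
      (2 * a - ω) * Real.exp (-(2 * ω * τ)) /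
        (2 * (Real.cosh (2 * ω * τ) + 2 * a * width ω τ)) := by
    have : 0 < 2 * a - ω := by linarith
    gcongr
    · exact hτ.2
    · exact (hM τ ⟨hτ.1.le, hτ.2⟩).trans (le_max_left _ _)
  linarith

end OneDim

section Prod

variable {ι : Type*} [Fintype ι] {a τ : ℝ}

lemma mehlerProd_mul_exp_eq (ω : ι → ℝ) (y z : EuclideanSpace ℝ ι) :
    mehlerProd ω τ y z * Real.exp (-a * ‖y‖ ^ 2) =
      ∏ i, (mehler (ω i) τ (y i) (z i) * Real.exp (-a * y i ^ 2)) := by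
  rw [Finset.prod_mul_distrib, ← Real.exp_sum, EuclideanSpace.norm_sq_eq, Finset.mul_sum,
    mehlerProd]
  simp

lemma integrable_mehlerProd_mul_exp (ω : ι → ℝ) (ha : 0 ≤ a) (hτ : 0 < τ)
    (z : EuclideanSpace ℝ ι) :
    Integrable fun y => mehlerProd ω τ y z * Real.exp (-a * ‖y‖ ^ 2) := by
  simp_rw [mehlerProd_mul_exp_eq]
  exact (PiLp.volume_preserving_ofLp ι).integrable_comp_of_integrable
    (Integrable.fintype_prod (μ := fun _ => volume) fun i =>
      integrable_mehler_mul_exp (ω i) ha hτ (z i))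

lemma integral_mehlerProd_mul_exp (ω : ι → ℝ) (ha : 0 ≤ a) (hτ : 0 < τ)
    (z : EuclideanSpace ℝ ι) :
    ∫ y, mehlerProd ω τ y z * Real.exp (-a * ‖y‖ ^ 2) =
      ∏ i, ((√(Real.cosh (2 * ω i * τ) + 2 * a * width (ω i) τ))⁻¹ *
        Real.exp (-((ω i ^ 2 * width (ω i) τ + 2 * a * Real.cosh (2 * ω i * τ)) /
          (2 * (Real.cosh (2 * ω i * τ) + 2 * a * width (ω i) τ))) * z i ^ 2)) := by
  simp_rw [mehlerProd_mul_exp_eq, ← integral_mehler_mul_exp _ ha hτ]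
  rw [← integral_fintype_prod_volume_eq_prod]
  exact (PiLp.volume_preserving_ofLp ι).integral_comp
    (MeasurableEquiv.toLp 2 (ι → ℝ)).symm.measurableEmbedding
    (fun y : ι → ℝ => ∏ i, (mehler (ω i) τ (y i) (z i) * Real.exp (-a * y i ^ 2)))

/-- The weight which defines admissible initial data. -/
def weight (ω : ι → ℝ) (ε : ℝ) (z : EuclideanSpace ℝ ι) : ℝ :=
  Real.exp (-(1 / 2) * (∑ i, ω i * z i ^ 2) - ε * ‖z‖ ^ 2)

lemma exists_integral_mehlerProd_mul_exp_le {ω : ι → ℝ} (hω : ∀ i, 0 ≤ ω i) (ha0 : 0 ≤ a)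
    (ha : ∀ i, ω i < 2 * a) (T : ℝ) : ∃ ε > 0, ∀ τ ∈ Ioc 0 T, ∀ z : EuclideanSpace ℝ ι,
      ∫ y, mehlerProd ω τ y z * Real.exp (-a * ‖y‖ ^ 2) ≤ weight ω ε z := by
  obtain ⟨ε, hε, hε0⟩ := ((eventually_all.2 fun i =>
    eventually_le_gaussian_rate (hω i) (ha i) T).and self_mem_nhdsWithin).exists
  refine ⟨ε, hε0, fun τ hτ z => ?_⟩
  rw [integral_mehlerProd_mul_exp ω ha0 hτ.1, weight, EuclideanSpace.norm_sq_eq, Finset.mul_sum,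
    Finset.mul_sum, ← Finset.sum_sub_distrib, Real.exp_sum]
  refine Finset.prod_le_prod (fun i _ => by positivity) fun i _ => ?_
  have hσ := width_pos (ω i) hτ.1
  have h1 : (√(Real.cosh (2 * ω i * τ) + 2 * a * width (ω i) τ))⁻¹ ≤ 1 := by
    refine inv_le_one_of_one_le₀ (Real.one_le_sqrt.2 ?_)
    have := Real.one_le_cosh (2 * ω i * τ)
    have : 0 ≤ 2 * a * width (ω i) τ := by positivity
    linarith
  refine (mul_le_of_le_one_left (Real.exp_pos _).le h1).trans (Real.exp_le_exp.2 ?_)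
  have := mul_le_mul_of_nonneg_right (hε i τ hτ) (sq_nonneg (z i))
  simp only [Real.norm_eq_abs, sq_abs]
  linarith

lemma integrable_mehlerProd (ω : ι → ℝ) (hτ : 0 < τ) (y : EuclideanSpace ℝ ι) :
    Integrable fun z => mehlerProd ω τ y z := by
  simpa [mehlerProd_symm ω τ y] using integrable_mehlerProd_mul_exp ω le_rfl hτ y

lemma integral_mehlerProd (ω : ι → ℝ) (hτ : 0 < τ) (y : EuclideanSpace ℝ ι) :
    ∫ z, mehlerProd ω τ y z = ∏ i, ((√(Real.cosh (2 * ω i * τ)))⁻¹ *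
        Real.exp (-((ω i ^ 2 * width (ω i) τ) / (2 * Real.cosh (2 * ω i * τ))) * y i ^ 2)) := by
  simpa [mehlerProd_symm ω τ y] using integral_mehlerProd_mul_exp ω le_rfl hτ y

lemma integral_mehlerProd_le_one (ω : ι → ℝ) (hτ : 0 < τ) (y : EuclideanSpace ℝ ι) :
    ∫ z, mehlerProd ω τ y z ≤ 1 := by
  rw [integral_mehlerProd ω hτ]
  refine Finset.prod_le_one (fun i _ => by positivity) fun i _ => ?_
  have hσ := width_pos (ω i) hτ
  have hc := Real.cosh_pos (2 * ω i * τ)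
  refine mul_le_one₀ (inv_le_one_of_one_le₀ (Real.one_le_sqrt.2 (Real.one_le_cosh _)))
    (Real.exp_pos _).le (Real.exp_le_one_iff.2 ?_)
  rw [neg_mul, neg_nonpos]
  positivity

/-- The potential makes the mass at most 1 instead of equal to 1; its explicit formula is continuous
up to `τ = 0`, where it equals 1. -/
lemma tendsto_integral_mehlerProd (ω : ι → ℝ) (y₀ : EuclideanSpace ℝ ι) :
    Tendsto (fun q : ℝ × EuclideanSpace ℝ ι => ∫ z, mehlerProd ω q.1 q.2 z)
      (𝓝[>] 0 ×ˢ 𝓝 y₀) (𝓝 1) := by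
  have hcont : Continuous fun q : ℝ × EuclideanSpace ℝ ι =>
      ∏ i, ((√(Real.cosh (2 * ω i * q.1)))⁻¹ *
        Real.exp (-((ω i ^ 2 * width (ω i) q.1) / (2 * Real.cosh (2 * ω i * q.1))) *
          q.2 i ^ 2)) := by
    have h1 : ∀ i, Continuous fun q : ℝ × EuclideanSpace ℝ ι => Real.cosh (2 * ω i * q.1) :=
      fun i => Real.continuous_cosh.comp (by fun_prop)
    have h2 : ∀ i, Continuous fun q : ℝ × EuclideanSpace ℝ ι => width (ω i) q.1 :=
      fun i => (contDiff_width (ω i) (k := 1)).continuous.comp continuous_fst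
    refine continuous_finsetProd _ fun i _ => ?_
    refine ((Real.continuous_sqrt.comp (h1 i)).inv₀ fun q => ?_).mul
      (Real.continuous_exp.comp ((((h2 i).const_mul _).div ((h1 i).const_mul _) fun q => ?_).neg.mul
        (by fun_prop)))
    · exact (Real.sqrt_pos.2 (Real.cosh_pos _)).ne'
    · have := Real.cosh_pos (2 * ω i * q.1)
      positivity
  have hlim := (hcont.tendsto (0, y₀)).mono_left
    (show 𝓝[>] (0 : ℝ) ×ˢ 𝓝 y₀ ≤ 𝓝 ((0 : ℝ), y₀) from by
      rw [nhds_prod_eq]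
      exact Filter.prod_mono nhdsWithin_le_nhds le_rfl)
  simp only [mul_zero, Real.cosh_zero, Real.sqrt_one, inv_one, width_zero, zero_div, neg_zero,
    zero_mul, Real.exp_zero, mul_one, Finset.prod_const_one] at hlim
  refine hlim.congr' ?_
  filter_upwards [prod_mem_prod self_mem_nhdsWithin univ_mem] with q hq
  exact (integral_mehlerProd ω hq.1 q.2).symm

end Prod

/-! ### Smoothness of the moment function of an exponential family. -/

section ExpFamily

variable {Ω κ : Type*} [MeasurableSpace Ω] {μ : Measure Ω} [Fintype κ] {S : Ω → κ → ℝ}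
  {f : Ω → ℝ} {U : Set (κ → ℝ)} {p : κ → ℝ}

/-- The moment function of the exponential family with sufficient statistic `S`, weighted by `f`. -/
def expMoment (μ : Measure Ω) (S : Ω → κ → ℝ) (f : Ω → ℝ) (p : κ → ℝ) : ℝ :=
  ∫ z, Real.exp (∑ i, p i * S z i) * f z ∂μ

lemma aestronglyMeasurable_of_integrable_exp_mul (hS : Measurable S)
    (hf : Integrable (fun z => Real.exp (∑ i, p i * S z i) * f z) μ) :
    AEStronglyMeasurable f μ := by
  have h1 : Measurable fun z => Real.exp (-∑ i, p i * S z i) := by fun_prop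
  refine (h1.aestronglyMeasurable.mul hf.aestronglyMeasurable).congr (ae_of_all _ fun z => ?_)
  simp only [Pi.mul_apply]
  rw [← mul_assoc, ← Real.exp_add, neg_add_cancel, Real.exp_zero, one_mul]

/-- For each `z`, `p·S + δ ∑ |S i|` is the exponent at one corner `p ± δ` of a cube inside `U`. The
sum of the finitely many corner integrands is therefore an integrable majorant; it dominates the
whole ball and, with room to spare, the derivatives. -/
lemma exists_integrable_exp_add_abs (hS : Measurable S) (hU : IsOpen U)
    (hf : ∀ p ∈ U, Integrable (fun z => Real.exp (∑ i, p i * S z i) * f z) μ) (hp : p ∈ U) :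
    ∃ δ > 0, Metric.ball p δ ⊆ U ∧
      Integrable (fun z => Real.exp (∑ i, p i * S z i + δ * ∑ i, |S z i|) * |f z|) μ := by
  classical
  obtain ⟨δ, hδ, hball⟩ := Metric.nhds_basis_closedBall.mem_iff.1 (hU.mem_nhds hp)
  refine ⟨δ, hδ, Metric.ball_subset_closedBall.trans hball, ?_⟩
  let sgn : Bool → ℝ := fun b => if b then 1 else -1
  have hq : ∀ b : κ → Bool, (fun i => p i + δ * sgn (b i)) ∈ U := fun b => by
    refine hball ?_
    rw [Metric.mem_closedBall, dist_pi_le_iff hδ.le]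
    intro i
    rw [Real.dist_eq, add_sub_cancel_left, abs_mul, abs_of_pos hδ]
    cases b i <;> simp [sgn]
  have hint := integrable_finsetSum (Finset.univ : Finset (κ → Bool))
    fun b _ => (hf _ (hq b)).norm
  have hfm := aestronglyMeasurable_of_integrable_exp_mul hS (hf p hp)
  refine hint.mono' ?_ (ae_of_all _ fun z => ?_)
  · have h1 : Measurable fun z => Real.exp (∑ i, p i * S z i + δ * ∑ i, |S z i|) := by
      have : ∀ i, Measurable fun z => |S z i| := fun i =>
        continuous_abs.measurable.comp (by fun_prop)
      fun_prop
    exact h1.aestronglyMeasurable.mul hfm.norm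
  · have h2 : ‖Real.exp (∑ i, p i * S z i + δ * ∑ i, |S z i|) * |f z|‖ =
        ‖Real.exp (∑ i, (p i + δ * sgn (decide (0 ≤ S z i))) * S z i) * f z‖ := by
      rw [norm_mul, norm_mul, Real.norm_eq_abs (|f z|), abs_abs, Real.norm_eq_abs (f z),
        Finset.mul_sum, ← Finset.sum_add_distrib]
      congr 4
      funext i
      by_cases h : 0 ≤ S z i
      · simp [sgn, h, abs_of_nonneg]
        ring
      · simp [sgn, h, abs_of_neg (not_le.1 h)]
        ring
    rw [h2]
    exact Finset.single_le_sum
      (f := fun b : κ → Bool => ‖Real.exp (∑ i, (p i + δ * sgn (b i)) * S z i) * f z‖)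
      (fun b _ => norm_nonneg _) (Finset.mem_univ fun i => decide (0 ≤ S z i))

lemma sum_mul_le_of_mem_ball {δ : ℝ} {q : κ → ℝ} (hq : q ∈ Metric.ball p δ) (s : κ → ℝ) :
    ∑ i, q i * s i ≤ ∑ i, p i * s i + δ * ∑ i, |s i| := by
  rw [Finset.mul_sum, ← Finset.sum_add_distrib]
  refine Finset.sum_le_sum fun i _ => ?_
  have h1 : |q i - p i| ≤ δ := by
    rw [← Real.dist_eq]
    exact (dist_le_pi_dist q p i).trans (Metric.mem_ball.1 hq).le
  have h2 : (q i - p i) * s i ≤ δ * |s i| := by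
    refine (le_abs_self _).trans ?_
    rw [abs_mul]
    gcongr
  linarith

/-- Half of `δ` pays for moving `p` to `q`; the other half absorbs the factor `∑ |S i|` through `x ≤
exp x`. -/
lemma exp_mul_sum_abs_le {δ : ℝ} (hδ : 0 < δ) {q : κ → ℝ} (hq : q ∈ Metric.ball p (δ / 2))
    (s : κ → ℝ) :
    Real.exp (∑ i, q i * s i) * ∑ i, |s i| ≤
      2 / δ * Real.exp (∑ i, p i * s i + δ * ∑ i, |s i|) := by
  have h1 := sum_mul_le_of_mem_ball hq s
  have h2 : ∑ i, |s i| ≤ 2 / δ * Real.exp (δ / 2 * ∑ i, |s i|) := by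
    have := Real.add_one_le_exp (δ / 2 * ∑ i, |s i|)
    rw [div_mul_eq_mul_div, le_div_iff₀ hδ]
    linarith
  calc Real.exp (∑ i, q i * s i) * ∑ i, |s i|
      ≤ Real.exp (∑ i, p i * s i + δ / 2 * ∑ i, |s i|) *
        (2 / δ * Real.exp (δ / 2 * ∑ i, |s i|)) := by
        gcongr
    _ = 2 / δ * (Real.exp (∑ i, p i * s i + δ / 2 * ∑ i, |s i|) *
          Real.exp (δ / 2 * ∑ i, |s i|)) := by ring
    _ = _ := by
      rw [← Real.exp_add]
      congr 2
      ring

/-- The integrability hypothesis passes from `f` to `S j * f`, which allows induction on the order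
of differentiation. -/
lemma integrable_exp_mul_statistic (hS : Measurable S) (hU : IsOpen U)
    (hf : ∀ p ∈ U, Integrable (fun z => Real.exp (∑ i, p i * S z i) * f z) μ) (j : κ)
    (hp : p ∈ U) : Integrable (fun z => Real.exp (∑ i, p i * S z i) * (S z j * f z)) μ := by
  obtain ⟨δ, hδ, -, hint⟩ := exists_integrable_exp_add_abs hS hU hf hp
  have hfm := aestronglyMeasurable_of_integrable_exp_mul hS (hf p hp)
  refine (hint.const_mul (2 / δ)).mono' ?_ (ae_of_all _ fun z => ?_)
  · have h1 : Measurable fun z => Real.exp (∑ i, p i * S z i) := by fun_prop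
    have h2 : Measurable fun z => S z j := by fun_prop
    exact h1.aestronglyMeasurable.mul (h2.aestronglyMeasurable.mul hfm)
  · rw [norm_mul, norm_mul, Real.norm_eq_abs, Real.abs_exp, ← mul_assoc, ← mul_assoc,
      Real.norm_eq_abs, Real.norm_eq_abs]
    refine mul_le_mul_of_nonneg_right ?_ (abs_nonneg _)
    refine le_trans ?_ (exp_mul_sum_abs_le hδ (Metric.mem_ball_self (half_pos hδ)) (S z))
    gcongr
    exact Finset.single_le_sum (f := fun i => |S z i|) (fun _ _ => abs_nonneg _)
      (Finset.mem_univ j)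

lemma hasFDerivAt_exp_sum_mul (s : κ → ℝ) (c : ℝ) (q : κ → ℝ) :
    HasFDerivAt (fun q : κ → ℝ => Real.exp (∑ i, q i * s i) * c)
      (∑ j, (Real.exp (∑ i, q i * s i) * (s j * c)) •
        (ContinuousLinearMap.proj j : (κ → ℝ) →L[ℝ] ℝ)) q := by
  have h1 : HasFDerivAt (fun q : κ → ℝ => ∑ i, q i * s i)
      (∑ i, s i • (ContinuousLinearMap.proj i : (κ → ℝ) →L[ℝ] ℝ)) q :=
    HasFDerivAt.fun_sum fun i _ => (hasFDerivAt_apply (𝕜 := ℝ) i q).mul_const (s i)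
  refine (h1.exp.mul_const c).congr_fderiv ?_
  ext v
  simp only [smul_apply, sum_apply, smul_eq_mul,
    Finset.mul_sum]
  exact Finset.sum_congr rfl fun j _ => by ring

lemma hasFDerivAt_expMoment (hS : Measurable S) (hU : IsOpen U)
    (hf : ∀ p ∈ U, Integrable (fun z => Real.exp (∑ i, p i * S z i) * f z) μ) (hp : p ∈ U) :
    HasFDerivAt (expMoment μ S f)
      (∑ j, expMoment μ S (fun z => S z j * f z) p •
        (ContinuousLinearMap.proj j : (κ → ℝ) →L[ℝ] ℝ)) p := by
  obtain ⟨δ, hδ, -, hint⟩ := exists_integrable_exp_add_abs hS hU hf hp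
  have hfm := aestronglyMeasurable_of_integrable_exp_mul hS (hf p hp)
  have hexp : ∀ q : κ → ℝ, Measurable fun z => Real.exp (∑ i, q i * S z i) := fun q => by fun_prop
  have hSj : ∀ j, Measurable fun z => S z j := fun j => by fun_prop
  have hint' : ∀ j, Integrable (fun z => (Real.exp (∑ i, p i * S z i) * (S z j * f z)) •
      (ContinuousLinearMap.proj j : (κ → ℝ) →L[ℝ] ℝ)) μ := fun j =>
    (integrable_exp_mul_statistic hS hU hf j hp).smul_const _
  have hb : ∀ z, ∀ q ∈ Metric.ball p (δ / 2), ‖∑ j, (Real.exp (∑ i, q i * S z i) * (S z j * f z)) •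
      (ContinuousLinearMap.proj j : (κ → ℝ) →L[ℝ] ℝ)‖ ≤
      2 / δ * (Real.exp (∑ i, p i * S z i + δ * ∑ i, |S z i|) * |f z|) := by
    intro z q hq
    refine (norm_sum_le _ _).trans ?_
    have h1 : ∀ j ∈ Finset.univ, ‖(Real.exp (∑ i, q i * S z i) * (S z j * f z)) •
        (ContinuousLinearMap.proj j : (κ → ℝ) →L[ℝ] ℝ)‖ ≤
        Real.exp (∑ i, q i * S z i) * |S z j| * |f z| := fun j _ => by
      rw [norm_smul, norm_mul, norm_mul, Real.norm_eq_abs, Real.abs_exp, ← mul_assoc]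
      refine mul_le_of_le_one_right (by positivity) ?_
      refine ContinuousLinearMap.opNorm_le_bound _ zero_le_one fun v => ?_
      rw [one_mul]
      exact norm_le_pi_norm v j
    refine (Finset.sum_le_sum h1).trans ?_
    rw [← Finset.sum_mul, ← Finset.mul_sum, ← mul_assoc]
    exact mul_le_mul_of_nonneg_right (exp_mul_sum_abs_le hδ hq (S z)) (abs_nonneg _)
  have hF' : AEStronglyMeasurable (fun z => ∑ j, (Real.exp (∑ i, p i * S z i) * (S z j * f z)) •
      (ContinuousLinearMap.proj j : (κ → ℝ) →L[ℝ] ℝ)) μ :=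
    Finset.aestronglyMeasurable_fun_sum _ fun j _ => (hint' j).aestronglyMeasurable
  obtain ⟨F', hF'_eq⟩ : ∃ F' : (κ → ℝ) → Ω → ((κ → ℝ) →L[ℝ] ℝ), ∀ q z, F' q z =
      ∑ j, (Real.exp (∑ i, q i * S z i) * (S z j * f z)) •
        (ContinuousLinearMap.proj j : (κ → ℝ) →L[ℝ] ℝ) := ⟨_, fun _ _ => rfl⟩
  simp_rw [← hF'_eq] at hb hF'
  have hd : ∀ z, ∀ q ∈ Metric.ball p (δ / 2),
      HasFDerivAt (fun q : κ → ℝ => Real.exp (∑ i, q i * S z i) * f z) (F' q z) q :=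
    fun z q _ => by
      rw [hF'_eq]
      exact hasFDerivAt_exp_sum_mul (S z) (f z) q
  have key : HasFDerivAt (expMoment μ S f) (∫ z, F' p z ∂μ) p :=
    hasFDerivAt_integral_of_dominated_of_fderiv_le (𝕜 := ℝ)
      (Metric.ball_mem_nhds p (half_pos hδ))
      (Eventually.of_forall fun q => (hexp q).aestronglyMeasurable.mul hfm) (hf p hp) hF'
      (ae_of_all _ hb) (hint.const_mul (2 / δ)) (ae_of_all _ hd)
  refine key.congr_fderiv ?_
  simp_rw [hF'_eq]
  rw [integral_finsetSum _ fun j _ => hint' j]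
  exact Finset.sum_congr rfl fun j _ => integral_smul_const _ _

lemma contDiffOn_expMoment (hS : Measurable S) (hU : IsOpen U)
    (hf : ∀ p ∈ U, Integrable (fun z => Real.exp (∑ i, p i * S z i) * f z) μ) (k : ℕ) :
    ContDiffOn ℝ k (expMoment μ S f) U := by
  induction k generalizing f with
  | zero =>
    rw [Nat.cast_zero, contDiffOn_zero]
    exact fun p hp => (hasFDerivAt_expMoment hS hU hf hp).continuousAt.continuousWithinAt
  | succ k ih =>
    rw [Nat.cast_succ, contDiffOn_succ_iff_fderiv_of_isOpen hU]
    refine ⟨fun p hp => (hasFDerivAt_expMoment hS hU hf hp).differentiableAt.differentiableWithinAt,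
      fun h => absurd h (by simp), ?_⟩
    have h1 : ContDiffOn ℝ k (fun p => ∑ j, expMoment μ S (fun z => S z j * f z) p •
        (ContinuousLinearMap.proj j : (κ → ℝ) →L[ℝ] ℝ)) U :=
      ContDiffOn.sum fun j _ =>
        (ih fun p hp => integrable_exp_mul_statistic hS hU hf j hp).smul contDiffOn_const
    exact h1.congr fun p hp => (hasFDerivAt_expMoment hS hU hf hp).fderiv

end ExpFamily

/-! ### The kernel integral as a Gaussian moment, and its derivatives. -/

section Evolution

variable {ι : Type*} [Fintype ι]

section Defs

/-- The statistic `(-z²/2, z)` of a Gaussian family. -/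
def gaussStat (z : EuclideanSpace ℝ ι) : ι ⊕ ι → ℝ :=
  Sum.elim (fun i => -(z i ^ 2 / 2)) fun i => z i

/-- The natural parameters of the Mehler kernel as a Gaussian in its last argument. -/
def gaussParam (ω : ι → ℝ) (τ : ℝ) (y : EuclideanSpace ℝ ι) : ι ⊕ ι → ℝ :=
  Sum.elim (fun i => diagCoeff (ω i) τ) fun i => crossCoeff (ω i) τ * y i

/-- The parameters for which moments of admissible data converge. -/
def paramSet (ω : ι → ℝ) : Set (ι ⊕ ι → ℝ) := {p | ∀ i, ω i < p (Sum.inl i)}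

/-- The logarithm of the factor of the Mehler kernel which does not depend on the last argument. -/
def logPrefactor (ω : ι → ℝ) (τ : ℝ) (y : EuclideanSpace ℝ ι) : ℝ :=
  ∑ i, (-(1 / 2) * Real.log (2 * Real.pi * width (ω i) τ) - diagCoeff (ω i) τ / 2 * y i ^ 2)

/-- Admissibility of the signed density `f` relative to the measure `μ`. -/
def IsAdmissible (ω : ι → ℝ) (μ : Measure (EuclideanSpace ℝ ι)) (f : EuclideanSpace ℝ ι → ℝ) :
    Prop :=
  ∀ ε : ℝ, 0 < ε → Integrable (fun z => weight ω ε z * f z) μ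

/-- The action of the Mehler kernel on the signed measure `f μ`. -/
def evolve (ω : ι → ℝ) (μ : Measure (EuclideanSpace ℝ ι)) (f : EuclideanSpace ℝ ι → ℝ)
    (τ : ℝ) (y : EuclideanSpace ℝ ι) : ℝ :=
  ∫ z, mehlerProd ω τ y z * f z ∂μ

end Defs

variable {ω : ι → ℝ} {μ : Measure (EuclideanSpace ℝ ι)} {f : EuclideanSpace ℝ ι → ℝ} {τ : ℝ}

lemma measurable_gaussStat : Measurable (gaussStat (ι := ι)) := by
  refine measurable_pi_lambda _ fun j => ?_
  rcases j with i | i <;> simp only [gaussStat, Sum.elim_inl, Sum.elim_inr] <;> fun_prop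

lemma isOpen_paramSet (ω : ι → ℝ) : IsOpen (paramSet ω) := by
  simp only [paramSet, ofPred_forall]
  exact isOpen_iInter_of_finite fun i => isOpen_lt continuous_const (continuous_apply _)

lemma gaussParam_mem (ω : ι → ℝ) (hτ : 0 < τ) (y : EuclideanSpace ℝ ι) :
    gaussParam ω τ y ∈ paramSet ω := fun i => lt_diagCoeff (ω i) hτ

lemma mehlerProd_eq_exp (ω : ι → ℝ) (hτ : 0 < τ) (y z : EuclideanSpace ℝ ι) :
    mehlerProd ω τ y z =
      Real.exp (logPrefactor ω τ y) * Real.exp (∑ j, gaussParam ω τ y j * gaussStat z j) := by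
  rw [← Real.exp_add, logPrefactor, Fintype.sum_sum_type, ← Finset.sum_add_distrib,
    ← Finset.sum_add_distrib, Real.exp_sum, mehlerProd]
  refine Finset.prod_congr rfl fun i _ => ?_
  have hw := width_pos (ω i) hτ
  have h1 : (√(2 * Real.pi * width (ω i) τ))⁻¹ =
      Real.exp (-(1 / 2) * Real.log (2 * Real.pi * width (ω i) τ)) := by
    rw [Real.sqrt_eq_rpow, ← Real.rpow_neg (by positivity), Real.rpow_def_of_pos (by positivity),
      mul_comm]
  rw [mehler, h1, ← Real.exp_add]
  congr 1
  simp only [gaussParam, gaussStat, Sum.elim_inl, Sum.elim_inr]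
  ring

lemma evolve_eq (ω : ι → ℝ) (μ : Measure (EuclideanSpace ℝ ι)) (f : EuclideanSpace ℝ ι → ℝ)
    (hτ : 0 < τ) (y : EuclideanSpace ℝ ι) :
    evolve ω μ f τ y =
      Real.exp (logPrefactor ω τ y) * expMoment μ gaussStat f (gaussParam ω τ y) := by
  simp_rw [evolve, expMoment, mehlerProd_eq_exp ω hτ, mul_assoc, integral_const_mul]

lemma weight_pos (ω : ι → ℝ) (ε : ℝ) (z : EuclideanSpace ℝ ι) : 0 < weight ω ε z := Real.exp_pos _

lemma continuous_weight (ω : ι → ℝ) (ε : ℝ) : Continuous (weight ω ε) := by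
  unfold weight
  fun_prop

lemma IsAdmissible.aestronglyMeasurable (hf : IsAdmissible ω μ f) : AEStronglyMeasurable f μ := by
  refine ((continuous_weight ω 1).inv₀ fun z => (weight_pos ω 1 z).ne').aestronglyMeasurable.mul
    (hf 1 one_pos).aestronglyMeasurable |>.congr (ae_of_all _ fun z => ?_)
  exact inv_mul_cancel_left₀ (weight_pos ω 1 z).ne' _

/-- The linear term is absorbed by `bz ≤ b²/(4ε) + εz²`. -/
lemma exists_exp_gaussStat_le {p : ι ⊕ ι → ℝ} (hp : p ∈ paramSet ω) :
    ∃ ε > 0, ∃ C : ℝ, ∀ z, Real.exp (∑ j, p j * gaussStat z j) ≤ C * weight ω ε z := by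
  -- The statistic is `-z²/2`, so a gap `4ε` is worth `2εz²`: one `ε` pays for the linear term and
  -- the other remains in the weight.
  have h1 : ∀ i, ∀ᶠ ε in 𝓝[>] (0 : ℝ), ω i + 4 * ε ≤ p (Sum.inl i) := fun i => by
    have : Tendsto (fun ε : ℝ => ω i + 4 * ε) (𝓝[>] 0) (𝓝 (ω i + 4 * 0)) :=
      (Continuous.tendsto (by fun_prop) 0).mono_left nhdsWithin_le_nhds
    exact this.eventually_le_const (by simpa using hp i)
  obtain ⟨ε, hε, hε0⟩ := ((eventually_all.2 h1).and self_mem_nhdsWithin).exists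
  have hε0 : 0 < ε := hε0
  refine ⟨ε, hε0, Real.exp (∑ i, p (Sum.inr i) ^ 2 / (4 * ε)), fun z => ?_⟩
  rw [weight, ← Real.exp_add]
  refine Real.exp_le_exp.2 ?_
  rw [Fintype.sum_sum_type, ← Finset.sum_add_distrib, EuclideanSpace.norm_sq_eq, Finset.mul_sum,
    Finset.mul_sum, ← Finset.sum_sub_distrib, ← Finset.sum_add_distrib]
  refine Finset.sum_le_sum fun i _ => ?_
  simp only [gaussStat, Sum.elim_inl, Sum.elim_inr, Real.norm_eq_abs, sq_abs]
  have h2 := mul_le_mul_of_nonneg_right (hε i) (sq_nonneg (z i))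
  have h3 : p (Sum.inr i) ^ 2 / (4 * ε) - p (Sum.inr i) * z i + ε * z i ^ 2 =
      (p (Sum.inr i) - 2 * ε * z i) ^ 2 / (4 * ε) := by
    field_simp
    ring
  have h4 : 0 ≤ (p (Sum.inr i) - 2 * ε * z i) ^ 2 / (4 * ε) := by positivity
  nlinarith

lemma IsAdmissible.integrable_exp_gaussStat (hf : IsAdmissible ω μ f) {p : ι ⊕ ι → ℝ}
    (hp : p ∈ paramSet ω) :
    Integrable (fun z => Real.exp (∑ j, p j * gaussStat z j) * f z) μ := by
  obtain ⟨ε, hε, C, hC⟩ := exists_exp_gaussStat_le hp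
  refine ((hf ε hε).norm.const_mul C).mono' ?_ (ae_of_all _ fun z => ?_)
  · have : Measurable fun z : EuclideanSpace ℝ ι => Real.exp (∑ j, p j * gaussStat z j) := by
      have := measurable_gaussStat (ι := ι)
      fun_prop
    exact this.aestronglyMeasurable.mul hf.aestronglyMeasurable
  · rw [norm_mul, norm_mul, Real.norm_eq_abs, Real.abs_exp, ← mul_assoc,
      Real.norm_of_nonneg (weight_pos ω ε z).le]
    exact mul_le_mul_of_nonneg_right (hC z) (norm_nonneg _)

lemma IsAdmissible.integrable_mehlerProd_mul (hf : IsAdmissible ω μ f) (hτ : 0 < τ)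
    (y : EuclideanSpace ℝ ι) : Integrable (fun z => mehlerProd ω τ y z * f z) μ := by
  simp_rw [mehlerProd_eq_exp ω hτ, mul_assoc]
  exact (hf.integrable_exp_gaussStat (gaussParam_mem ω hτ y)).const_mul _

/-- The weight is itself the member of the exponential family with parameters `(ω + 2ε, 0)`, which
lie in the open set of parameters, so a factor from the statistic does not destroy integrability. -/
lemma IsAdmissible.coord_mul (hf : IsAdmissible ω μ f) (i : ι) :
    IsAdmissible ω μ fun z => z i * f z := by
  intro ε hε
  let p : ι ⊕ ι → ℝ := Sum.elim (fun i => ω i + 2 * ε) 0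
  have hp : p ∈ paramSet ω := fun i => by simp [p]; exact hε
  have := integrable_exp_mul_statistic measurable_gaussStat (isOpen_paramSet ω)
    (fun p hp => hf.integrable_exp_gaussStat hp) (Sum.inr i) hp
  refine this.congr (ae_of_all _ fun z => ?_)
  simp only [gaussStat, Sum.elim_inr, weight]
  congr 2
  rw [Fintype.sum_sum_type, EuclideanSpace.norm_sq_eq, Finset.mul_sum, Finset.mul_sum,
    ← Finset.sum_sub_distrib]
  simp only [p, Sum.elim_inl, Sum.elim_inr, Pi.zero_apply, zero_mul, Finset.sum_const_zero,
    add_zero]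
  refine Finset.sum_congr rfl fun i _ => ?_
  simp only [Real.norm_eq_abs, sq_abs]
  ring

lemma IsAdmissible.hasFDerivAt_expMoment (hf : IsAdmissible ω μ f) {p : ι ⊕ ι → ℝ}
    (hp : p ∈ paramSet ω) :
    HasFDerivAt (expMoment μ gaussStat f)
      (∑ j, expMoment μ gaussStat (fun z => gaussStat z j * f z) p •
        (ContinuousLinearMap.proj j : (ι ⊕ ι → ℝ) →L[ℝ] ℝ)) p :=
  QuadraticSB.hasFDerivAt_expMoment measurable_gaussStat (isOpen_paramSet ω)
    (fun _ hp => hf.integrable_exp_gaussStat hp) hp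

lemma sum_smul_proj_apply {κ : Type*} [Fintype κ] (m v : κ → ℝ) :
    (∑ j, m j • (ContinuousLinearMap.proj j : (κ → ℝ) →L[ℝ] ℝ)) v = ∑ j, m j * v j := by
  simp only [sum_apply, smul_apply, ContinuousLinearMap.proj_apply, smul_eq_mul]

lemma expMoment_gaussStat_inl (i : ι) (p : ι ⊕ ι → ℝ) :
    expMoment μ gaussStat (fun z => gaussStat z (Sum.inl i) * f z) p =
      -(1 / 2) * expMoment μ gaussStat (fun z => z i * (z i * f z)) p := by
  rw [expMoment, expMoment, ← integral_const_mul]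
  congr 1
  ext z
  simp only [gaussStat, Sum.elim_inl]
  ring

lemma contDiffOn_logPrefactor (ω : ι → ℝ) (k : ℕ) :
    ContDiffOn ℝ k (fun q : ℝ × EuclideanSpace ℝ ι => logPrefactor ω q.1 q.2)
      (Ioi 0 ×ˢ univ) := by
  intro q hq
  have hq : 0 < q.1 := hq.1
  refine ContDiffAt.contDiffWithinAt ?_
  unfold logPrefactor
  refine ContDiffAt.sum fun i _ => ?_
  have h1 : ContDiffAt ℝ k (fun q : ℝ × EuclideanSpace ℝ ι => width (ω i) q.1) q :=
    ((contDiff_width (ω i)).comp contDiff_fst).contDiffAt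
  have h2 : ContDiffAt ℝ k (fun q : ℝ × EuclideanSpace ℝ ι => diagCoeff (ω i) q.1) q :=
    (contDiffAt_diagCoeff (ω i) hq).comp q contDiff_fst.contDiffAt
  have h3 := width_pos (ω i) hq
  refine (contDiffAt_const.mul ((contDiffAt_const.mul h1).log ?_)).sub
    ((h2.div_const 2).mul (ContDiff.contDiffAt (by fun_prop)))
  positivity

lemma contDiffOn_gaussParam (ω : ι → ℝ) (k : ℕ) :
    ContDiffOn ℝ k (fun q : ℝ × EuclideanSpace ℝ ι => gaussParam ω q.1 q.2)
      (Ioi 0 ×ˢ univ) := by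
  intro q hq
  have hq : 0 < q.1 := hq.1
  refine ContDiffAt.contDiffWithinAt (contDiffAt_pi.2 fun j => ?_)
  rcases j with i | i
  · exact (contDiffAt_diagCoeff (ω i) hq).comp q contDiff_fst.contDiffAt
  · exact ((contDiffAt_crossCoeff (ω i) hq).comp q contDiff_fst.contDiffAt).mul
      (ContDiff.contDiffAt (by fun_prop))

lemma IsAdmissible.contDiffOn_evolve (hf : IsAdmissible ω μ f) (k : ℕ) :
    ContDiffOn ℝ k (fun q : ℝ × EuclideanSpace ℝ ι => evolve ω μ f q.1 q.2)
      (Ioi 0 ×ˢ univ) := by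
  have h1 := (contDiffOn_expMoment (μ := μ) measurable_gaussStat (isOpen_paramSet ω)
    (fun p hp => hf.integrable_exp_gaussStat hp) k).comp (contDiffOn_gaussParam ω k)
    (fun q hq => gaussParam_mem ω hq.1 q.2)
  exact ((contDiffOn_logPrefactor ω k).exp.mul h1).congr fun q hq => evolve_eq ω μ f hq.1 q.2

lemma hasDerivAt_logPrefactor_time (ω : ι → ℝ) (hτ : 0 < τ) (y : EuclideanSpace ℝ ι) :
    HasDerivAt (fun τ => logPrefactor ω τ y)
      (∑ i, (-diagCoeff (ω i) τ + crossCoeff (ω i) τ ^ 2 * y i ^ 2)) τ := by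
  unfold logPrefactor
  refine HasDerivAt.fun_sum fun i _ => ?_
  have hw := width_pos (ω i) hτ
  refine ((((hasDerivAt_width (ω i) τ).const_mul (2 * Real.pi)).log (by positivity)).const_mul
    (-(1 / 2)) |>.sub
      (((hasDerivAt_diagCoeff (ω i) hτ).div_const 2).mul_const (y i ^ 2))).congr_deriv ?_
  have := Real.pi_pos
  simp only [diagCoeff]
  field_simp
  ring

lemma IsAdmissible.hasDerivAt_evolve_time (hf : IsAdmissible ω μ f) (hτ : 0 < τ)
    (y : EuclideanSpace ℝ ι) :
    HasDerivAt (fun τ => evolve ω μ f τ y)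
      (∑ i, ((-diagCoeff (ω i) τ + crossCoeff (ω i) τ ^ 2 * y i ^ 2) * evolve ω μ f τ y -
        2 * diagCoeff (ω i) τ * crossCoeff (ω i) τ * y i * evolve ω μ (fun z => z i * f z) τ y +
        crossCoeff (ω i) τ ^ 2 * evolve ω μ (fun z => z i * (z i * f z)) τ y)) τ := by
  have hp : HasDerivAt (fun τ => gaussParam ω τ y)
      (Sum.elim (fun i => -2 * crossCoeff (ω i) τ ^ 2)
        fun i => -2 * diagCoeff (ω i) τ * crossCoeff (ω i) τ * y i) τ := by
    refine hasDerivAt_pi.2 fun j => ?_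
    rcases j with i | i
    · exact hasDerivAt_diagCoeff (ω i) hτ
    · exact (hasDerivAt_crossCoeff (ω i) hτ).mul_const (y i)
  have h1 := (hasDerivAt_logPrefactor_time ω hτ y).exp.mul
    ((hf.hasFDerivAt_expMoment (gaussParam_mem ω hτ y)).comp_hasDerivAt τ hp)
  refine (h1.congr_of_eventuallyEq ?_).congr_deriv ?_
  · filter_upwards [Ioi_mem_nhds hτ] with s hs
    exact evolve_eq ω μ f hs y
  · rw [sum_smul_proj_apply]
    simp only [evolve_eq ω μ _ hτ, Fintype.sum_sum_type, Sum.elim_inl, Sum.elim_inr,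
      expMoment_gaussStat_inl, Finset.mul_sum, Finset.sum_mul, mul_add, Function.comp_apply]
    rw [← Finset.sum_add_distrib, ← Finset.sum_add_distrib]
    refine Finset.sum_congr rfl fun i _ => ?_
    simp only [gaussStat, Sum.elim_inr]
    ring

variable [DecidableEq ι]

lemma hasDerivAt_coord_line (y : EuclideanSpace ℝ ι) (i j : ι) :
    HasDerivAt (fun s : ℝ => (y + s • EuclideanSpace.single i (1 : ℝ)) j)
      (if j = i then 1 else 0) 0 := by
  have : (fun s : ℝ => (y + s • EuclideanSpace.single i (1 : ℝ)) j) =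
      fun s : ℝ => y j + s * (if j = i then 1 else 0) := by
    ext s
    simp
  rw [this]
  simpa using ((hasDerivAt_id (0 : ℝ)).mul_const (if j = i then (1 : ℝ) else 0)).const_add (y j)

lemma IsAdmissible.hasLineDerivAt_evolve (hf : IsAdmissible ω μ f) (hτ : 0 < τ)
    (y : EuclideanSpace ℝ ι) (i : ι) :
    HasLineDerivAt ℝ (evolve ω μ f τ)
      (-diagCoeff (ω i) τ * y i * evolve ω μ f τ y +
        crossCoeff (ω i) τ * evolve ω μ (fun z => z i * f z) τ y) y
      (EuclideanSpace.single i 1) := by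
  have hγ : HasDerivAt (fun s : ℝ => logPrefactor ω τ (y + s • EuclideanSpace.single i (1 : ℝ)))
      (∑ j, -(diagCoeff (ω j) τ * y j * if j = i then 1 else 0)) 0 := by
    unfold logPrefactor
    refine HasDerivAt.fun_sum fun j _ => ?_
    refine ((((hasDerivAt_coord_line y i j).pow 2).const_mul
      (diagCoeff (ω j) τ / 2)).const_sub _).congr_deriv ?_
    simp
    ring_nf
  have hp : HasDerivAt (fun s : ℝ => gaussParam ω τ (y + s • EuclideanSpace.single i (1 : ℝ)))
      (Sum.elim (fun _ => 0) fun j => crossCoeff (ω j) τ * if j = i then 1 else 0) 0 := by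
    refine hasDerivAt_pi.2 fun j => ?_
    rcases j with j | j
    · exact hasDerivAt_const _ _
    · exact (hasDerivAt_coord_line y i j).const_mul _
  have h0 : y + (0 : ℝ) • EuclideanSpace.single i (1 : ℝ) = y := by simp
  have hm : HasFDerivAt (expMoment μ gaussStat f)
      (∑ j, expMoment μ gaussStat (fun z => gaussStat z j * f z) (gaussParam ω τ y) •
        (ContinuousLinearMap.proj j : (ι ⊕ ι → ℝ) →L[ℝ] ℝ))
      (gaussParam ω τ (y + (0 : ℝ) • EuclideanSpace.single i (1 : ℝ))) := by
    rw [h0]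
    exact hf.hasFDerivAt_expMoment (gaussParam_mem ω hτ y)
  have h1 := hγ.exp.mul (hm.comp_hasDerivAt (0 : ℝ) hp)
  unfold HasLineDerivAt
  refine (h1.congr_of_eventuallyEq (Eventually.of_forall fun s => ?_)).congr_deriv ?_
  · exact evolve_eq ω μ f hτ _
  · rw [sum_smul_proj_apply]
    simp only [evolve_eq ω μ _ hτ, Fintype.sum_sum_type, Sum.elim_inl, Sum.elim_inr,
      Function.comp_apply, h0,
      mul_zero, Finset.sum_const_zero, zero_add, mul_ite, mul_one, Finset.sum_ite_eq',
      Finset.mem_univ, if_true, Finset.sum_neg_distrib, gaussStat]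
    ring

end Evolution

/-! ### Regularity of time slices and the Laplacian in coordinates. -/

section Regularity

variable {E F : Type*} [NormedAddCommGroup E] [NormedSpace ℝ E] [NormedAddCommGroup F]
  [NormedSpace ℝ F] {U : ℝ → E → F} {I : Set ℝ}

lemma contDiffOn_fderiv_snd {m k : WithTop ℕ∞} (hI : IsOpen I)
    (hU : ContDiffOn ℝ m (fun q : ℝ × E => U q.1 q.2) (I ×ˢ univ)) (hk : k + 1 ≤ m) :
    ContDiffOn ℝ k (fun q : ℝ × E => fderiv ℝ (U q.1) q.2) (I ×ˢ univ) := by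
  intro q hq
  refine ContDiffAt.contDiffWithinAt ?_
  have h1 : ContDiffAt ℝ m (fun q : ℝ × E => U q.1 q.2) (q.1, q.2) :=
    (hU q hq).contDiffAt ((hI.prod isOpen_univ).mem_nhds hq)
  have h2 : ContDiffAt ℝ m (Function.uncurry fun (q : ℝ × E) (y : E) => U q.1 y) (q, q.2) := by
    have h3 : ContDiffAt ℝ m (fun r : (ℝ × E) × E => (r.1.1, r.2)) (q, q.2) :=
      ContDiff.contDiffAt (by fun_prop)
    exact ContDiffAt.comp (q, q.2) (g := fun q : ℝ × E => U q.1 q.2) h1 h3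
  exact ContDiffAt.fderiv (f := fun (q : ℝ × E) (y : E) => U q.1 y) h2 contDiffAt_snd hk

lemma contDiff_slice {m : WithTop ℕ∞}
    (hU : ContDiffOn ℝ m (fun q : ℝ × E => U q.1 q.2) (I ×ˢ univ)) {t : ℝ} (ht : t ∈ I) :
    ContDiff ℝ m (U t) := by
  rw [← contDiffOn_univ]
  exact hU.comp (f := fun y : E => (t, y)) (ContDiff.contDiffOn (by fun_prop))
    fun y _ => ⟨ht, mem_univ _⟩

end Regularity

section Laplacian

variable {ι : Type*} [Fintype ι] [DecidableEq ι]

lemma laplacian_eq_sum_fderiv {f : EuclideanSpace ℝ ι → ℝ} {y : EuclideanSpace ℝ ι}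
    (hf : DifferentiableAt ℝ (fderiv ℝ f) y) :
    Laplacian.laplacian f y = ∑ i, fderiv ℝ (fun x => fderiv ℝ f x (EuclideanSpace.single i 1)) y
      (EuclideanSpace.single i 1) := by
  rw [InnerProductSpace.laplacian_eq_iteratedFDeriv_orthonormalBasis f
    (EuclideanSpace.basisFun ι ℝ)]
  refine Finset.sum_congr rfl fun i _ => ?_
  rw [iteratedFDeriv_two_apply, fderiv_clm_apply hf (differentiableAt_const _)]
  simp

lemma laplacian_eq_sum_fderiv_fderiv {f : EuclideanSpace ℝ ι → ℝ} {y : EuclideanSpace ℝ ι} :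
    Laplacian.laplacian f y = ∑ i, fderiv ℝ (fderiv ℝ f) y (EuclideanSpace.single i 1)
      (EuclideanSpace.single i 1) := by
  rw [InnerProductSpace.laplacian_eq_iteratedFDeriv_orthonormalBasis f
    (EuclideanSpace.basisFun ι ℝ)]
  refine Finset.sum_congr rfl fun i _ => ?_
  rw [iteratedFDeriv_two_apply]
  simp

end Laplacian

/-! ### The differential equation for the kernel integral. -/

section Evolve

variable {ι : Type*} [Fintype ι] [DecidableEq ι] {ω : ι → ℝ} {μ : Measure (EuclideanSpace ℝ ι)}
  {f : EuclideanSpace ℝ ι → ℝ} {τ : ℝ}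

lemma IsAdmissible.contDiff_evolve (hf : IsAdmissible ω μ f) (hτ : 0 < τ) (k : ℕ) :
    ContDiff ℝ k (evolve ω μ f τ) :=
  contDiff_slice (hf.contDiffOn_evolve k) hτ

lemma IsAdmissible.fderiv_evolve (hf : IsAdmissible ω μ f) (hτ : 0 < τ)
    (y : EuclideanSpace ℝ ι) (i : ι) :
    fderiv ℝ (evolve ω μ f τ) y (EuclideanSpace.single i 1) =
      -diagCoeff (ω i) τ * y i * evolve ω μ f τ y +
        crossCoeff (ω i) τ * evolve ω μ (fun z => z i * f z) τ y := by
  rw [← (hf.hasLineDerivAt_evolve hτ y i).lineDeriv,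
    ((hf.contDiff_evolve hτ 1).differentiable one_ne_zero y).lineDeriv_eq_fderiv]

lemma IsAdmissible.laplacian_evolve (hf : IsAdmissible ω μ f) (hτ : 0 < τ)
    (y : EuclideanSpace ℝ ι) :
    Laplacian.laplacian (evolve ω μ f τ) y =
      ∑ i, ((-diagCoeff (ω i) τ + diagCoeff (ω i) τ ^ 2 * y i ^ 2) * evolve ω μ f τ y -
        2 * diagCoeff (ω i) τ * crossCoeff (ω i) τ * y i * evolve ω μ (fun z => z i * f z) τ y +
        crossCoeff (ω i) τ ^ 2 * evolve ω μ (fun z => z i * (z i * f z)) τ y) := by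
  have hdiff : Differentiable ℝ (fderiv ℝ (evolve ω μ f τ)) :=
    ((hf.contDiff_evolve hτ 2).fderiv_right (m := 1) (by norm_num)).differentiable one_ne_zero
  rw [laplacian_eq_sum_fderiv (hdiff y)]
  refine Finset.sum_congr rfl fun i _ => ?_
  have h1 : HasLineDerivAt ℝ
      (fun x => fderiv ℝ (evolve ω μ f τ) x (EuclideanSpace.single i 1)) _ y
      (EuclideanSpace.single i 1) :=
    ((hdiff y).clm_apply (differentiableAt_const _)).hasFDerivAt.hasLineDerivAt _
  refine h1.unique ?_
  simp_rw [hf.fderiv_evolve hτ]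
  have h2 : HasLineDerivAt ℝ (fun x : EuclideanSpace ℝ ι => x i) 1 y
      (EuclideanSpace.single i 1) := by
    have := hasDerivAt_coord_line y i i
    simpa [HasLineDerivAt] using this
  have h3 := ((HasDerivAt.const_mul (-diagCoeff (ω i) τ) h2).mul
    (hf.hasLineDerivAt_evolve hτ y i)).add
      (HasDerivAt.const_mul (crossCoeff (ω i) τ) ((hf.coord_mul i).hasLineDerivAt_evolve hτ y i))
  refine HasDerivAt.congr_deriv h3 ?_
  simp only [zero_smul, add_zero]
  ring

lemma IsAdmissible.hasDerivAt_evolve (hf : IsAdmissible ω μ f) (hτ : 0 < τ)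
    (y : EuclideanSpace ℝ ι) :
    HasDerivAt (fun τ => evolve ω μ f τ y)
      (Laplacian.laplacian (evolve ω μ f τ) y - (∑ i, ω i ^ 2 * y i ^ 2) * evolve ω μ f τ y) τ := by
  refine (hf.hasDerivAt_evolve_time hτ y).congr_deriv ?_
  rw [hf.laplacian_evolve hτ, Finset.sum_mul, ← Finset.sum_sub_distrib]
  refine Finset.sum_congr rfl fun i _ => ?_
  -- The moment formulas for the time derivative and the Laplacian differ only in the coefficient of
  -- `y i ^ 2`: `B²` against `A²`.
  linear_combination (y i ^ 2 * evolve ω μ f τ y) * crossCoeff_sq (ω i) hτ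

end Evolve

/-! ### Attainment of the initial data and Gaussian growth. -/

section InitialValue

variable {ι : Type*} [Fintype ι] {ω : ι → ℝ} {f g : EuclideanSpace ℝ ι → ℝ} {τ a ε : ℝ}

lemma integrable_exp_neg_mul_norm_sq (ha : 0 < a) :
    Integrable fun z : EuclideanSpace ℝ ι => Real.exp (-a * ‖z‖ ^ 2) := by
  have h := (GaussianFourier.integrable_cexp_neg_mul_sq_norm_add (V := EuclideanSpace ℝ ι)
    (b := (a : ℂ)) (by simpa using ha) 0 0).norm
  refine h.congr (ae_of_all _ fun z => ?_)
  simp only [Complex.norm_exp]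
  congr 1
  have : -(a : ℂ) * (‖z‖ : ℂ) ^ 2 = ((-a * ‖z‖ ^ 2 : ℝ) : ℂ) := by push_cast; ring
  simp only [zero_mul, add_zero]
  rw [this, Complex.ofReal_re]

lemma weight_anti {ε' : ℝ} (h : ε ≤ ε') (z : EuclideanSpace ℝ ι) :
    weight ω ε' z ≤ weight ω ε z := by
  unfold weight
  gcongr

/-- A rate for which the centred Gaussian is below the weights of admissible data. -/
def gaussRate (ω : ι → ℝ) : ℝ := ∑ i, ω i + 1

lemma gaussRate_pos (hω : ∀ i, 0 ≤ ω i) : 0 < gaussRate ω := by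
  have := Finset.sum_nonneg fun i (_ : i ∈ Finset.univ) => hω i
  unfold gaussRate
  linarith

lemma lt_two_mul_gaussRate (hω : ∀ i, 0 ≤ ω i) (i : ι) : ω i < 2 * gaussRate ω := by
  have := Finset.single_le_sum (fun i _ => hω i) (Finset.mem_univ i)
  have := gaussRate_pos hω
  unfold gaussRate at *
  linarith

lemma exp_gaussRate_le_weight (hω : ∀ i, 0 ≤ ω i) (hε : ε ≤ 1) (z : EuclideanSpace ℝ ι) :
    Real.exp (-gaussRate ω * ‖z‖ ^ 2) ≤ weight ω ε z := by
  refine le_trans (Real.exp_le_exp.2 ?_) (weight_anti hε z)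
  have h1 : ∑ i, ω i * z i ^ 2 ≤ (∑ i, ω i) * ‖z‖ ^ 2 := by
    rw [Finset.sum_mul]
    refine Finset.sum_le_sum fun i _ => mul_le_mul_of_nonneg_left ?_ (hω i)
    rw [EuclideanSpace.norm_sq_eq]
    refine le_trans (le_of_eq ?_)
      (Finset.single_le_sum (f := fun i => ‖z i‖ ^ 2) (fun _ _ => by positivity)
        (Finset.mem_univ i))
    simp
  have h2 : 0 ≤ ∑ i, ω i * z i ^ 2 :=
    Finset.sum_nonneg fun i _ => mul_nonneg (hω i) (sq_nonneg _)
  unfold gaussRate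
  linarith

lemma IsAdmissible.integrable_exp_mul (hω : ∀ i, 0 ≤ ω i) (hf : IsAdmissible ω volume f) :
    Integrable fun z => Real.exp (-gaussRate ω * ‖z‖ ^ 2) * f z := by
  refine (hf 1 one_pos).mono (AEStronglyMeasurable.mul
    (Continuous.aestronglyMeasurable (by fun_prop)) hf.aestronglyMeasurable)
      (ae_of_all _ fun z => ?_)
  rw [norm_mul, norm_mul, Real.norm_eq_abs, Real.norm_eq_abs (weight ω 1 z),
    abs_of_pos (weight_pos ω 1 z), Real.abs_exp]
  exact mul_le_mul_of_nonneg_right (exp_gaussRate_le_weight hω le_rfl z) (norm_nonneg _)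

lemma isAdmissible_of_hasCompactSupport (hg : Continuous g) (hc : HasCompactSupport g) :
    IsAdmissible ω volume g := fun ε _ =>
  ((continuous_weight ω ε).mul hg).integrable_of_hasCompactSupport hc.mul_left

/-- The Mehler kernel attains continuous values of the initial data. -/
lemma IsAdmissible.tendsto_evolve (hω : ∀ i, 0 ≤ ω i) (hf : IsAdmissible ω volume f)
    {y₀ : EuclideanSpace ℝ ι} (hc : ContinuousAt f y₀) :
    Tendsto (fun q : ℝ × EuclideanSpace ℝ ι => evolve ω volume f q.1 q.2)
      (𝓝[>] 0 ×ˢ 𝓝 y₀) (𝓝 (f y₀)) := by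
  have hmass := (tendsto_integral_mehlerProd ω y₀).const_mul (f y₀)
  rw [mul_one] at hmass
  -- Subtracting `f y₀` times the mass, which is not 1, turns the integrand into the kernel times `f
  -- z - f y₀`.
  suffices h : Tendsto (fun q : ℝ × EuclideanSpace ℝ ι => evolve ω volume f q.1 q.2 -
      f y₀ * ∫ z, mehlerProd ω q.1 q.2 z) (𝓝[>] 0 ×ˢ 𝓝 y₀) (𝓝 0) by
    simpa using h.add hmass
  set Λ := gaussRate ω
  have hint1 := hf.integrable_exp_mul hω
  have hint2 := integrable_exp_neg_mul_norm_sq (ι := ι) (gaussRate_pos hω)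
  set C := ∫ z, (‖Real.exp (-Λ * ‖z‖ ^ 2) * f z‖ + Real.exp (-Λ * ‖z‖ ^ 2) * |f y₀|)
  rw [Metric.tendsto_nhds]
  intro η hη
  obtain ⟨r, hr, hfr⟩ := Metric.continuousAt_iff.1 hc (η / 2) (half_pos hη)
  set M := ‖y₀‖ + r / 2
  have hM : 0 < M := by positivity
  -- For `‖z - y₀‖ ≥ r` and `‖y - y₀‖ < r/2`, both `‖y - z‖ ≥ r/2` and `‖z‖ ≤ ‖y - z‖ + M ≤ (1 +
  -- 2M/r)‖y - z‖` hold; these are the two conditions of the far-field bound.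
  have hcpos : 0 < min (r / 2) (r / (r + 2 * M)) := by positivity
  have hsmall : ∀ᶠ τ in 𝓝[>] (0 : ℝ), τ ^ 2 * C < η / 2 := by
    have : Tendsto (fun τ : ℝ => τ ^ 2 * C) (𝓝[>] 0) (𝓝 (0 ^ 2 * C)) :=
      (Continuous.tendsto (by fun_prop) 0).mono_left nhdsWithin_le_nhds
    exact this.eventually_lt_const (by simpa using half_pos hη)
  have hτ := (eventually_mehlerProd_le_of_far ω hcpos Λ).and
    (hsmall.and (self_mem_nhdsWithin (a := (0 : ℝ)) (s := Ioi 0)))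
  have hy : ∀ᶠ y in 𝓝 y₀, ‖y - y₀‖ < r / 2 := by
    filter_upwards [Metric.ball_mem_nhds y₀ (half_pos hr)] with y hy
    rwa [← dist_eq_norm]
  filter_upwards [hτ.prod_mk hy] with q hq
  obtain ⟨⟨hK, hs, hτ0⟩, hy⟩ := hq
  have hτ0 : 0 < q.1 := hτ0
  rw [dist_zero_right, evolve, ← integral_const_mul,
    ← integral_sub (hf.integrable_mehlerProd_mul hτ0 _)
      ((integrable_mehlerProd ω hτ0 _).const_mul _)]
  have hbound : ∀ z, ‖mehlerProd ω q.1 q.2 z * f z - f y₀ * mehlerProd ω q.1 q.2 z‖ ≤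
      η / 2 * mehlerProd ω q.1 q.2 z + q.1 ^ 2 * (‖Real.exp (-Λ * ‖z‖ ^ 2) * f z‖ +
        Real.exp (-Λ * ‖z‖ ^ 2) * |f y₀|) := fun z => by
    have hKpos := mehlerProd_pos ω hτ0 q.2 z
    have h1 : ‖mehlerProd ω q.1 q.2 z * f z - f y₀ * mehlerProd ω q.1 q.2 z‖ =
        mehlerProd ω q.1 q.2 z * |f z - f y₀| := by
      rw [mul_comm (f y₀), ← mul_sub, norm_mul, Real.norm_of_nonneg hKpos.le, Real.norm_eq_abs]
    rw [h1]
    by_cases hz : dist z y₀ < r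
    · have h2 : |f z - f y₀| ≤ η / 2 := (hfr hz).le
      have h3 := mul_le_mul_of_nonneg_left h2 hKpos.le
      have h4 : 0 ≤ q.1 ^ 2 * (‖Real.exp (-Λ * ‖z‖ ^ 2) * f z‖ +
        Real.exp (-Λ * ‖z‖ ^ 2) * |f y₀|) := by positivity
      linarith
    · rw [not_lt, dist_eq_norm] at hz
      have h5 : r / 2 ≤ ‖q.2 - z‖ := by
        have := norm_sub_le_norm_sub_add_norm_sub z q.2 y₀
        rw [norm_sub_rev z q.2] at this
        linarith
      have h6 : r / (r + 2 * M) * ‖z‖ ≤ ‖q.2 - z‖ := by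
        have h7 : ‖z‖ ≤ ‖q.2 - z‖ + M := by
          have e1 : ‖z‖ ≤ ‖q.2 - z‖ + ‖q.2‖ := by
            have := norm_sub_norm_le z q.2
            rw [norm_sub_rev] at this
            linarith
          have e2 : ‖q.2‖ ≤ ‖q.2 - y₀‖ + ‖y₀‖ := by
            have := norm_sub_norm_le q.2 y₀
            linarith
          simp only [M]
          linarith
        rw [div_mul_eq_mul_div, div_le_iff₀ (by positivity)]
        nlinarith
      have h8 := hK q.2 z ((min_le_left _ _).trans h5)
        ((mul_le_mul_of_nonneg_right (min_le_right _ _) (norm_nonneg _)).trans h6)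
      have h9 : |f z - f y₀| ≤ |f z| + |f y₀| := abs_sub _ _
      have h10 : 0 ≤ η / 2 * mehlerProd ω q.1 q.2 z := by positivity
      calc mehlerProd ω q.1 q.2 z * |f z - f y₀|
          ≤ q.1 ^ 2 * Real.exp (-Λ * ‖z‖ ^ 2) * (|f z| + |f y₀|) := by gcongr
        _ = q.1 ^ 2 * (‖Real.exp (-Λ * ‖z‖ ^ 2) * f z‖ + Real.exp (-Λ * ‖z‖ ^ 2) * |f y₀|) := by
          rw [norm_mul, Real.norm_eq_abs, Real.norm_eq_abs, Real.abs_exp]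
          ring
        _ ≤ _ := by linarith
  have hint := ((integrable_mehlerProd ω hτ0 q.2).const_mul (η / 2))
  have hint' : Integrable fun z => q.1 ^ 2 * (‖Real.exp (-Λ * ‖z‖ ^ 2) * f z‖ +
      Real.exp (-Λ * ‖z‖ ^ 2) * |f y₀|) :=
    (hint1.norm.add (hint2.mul_const |f y₀|)).const_mul (q.1 ^ 2)
  refine (norm_integral_le_of_norm_le (hint.add hint') (ae_of_all _ hbound)).trans_lt ?_
  have hsum : ∫ z, (η / 2 * mehlerProd ω q.1 q.2 z + q.1 ^ 2 *
      (‖Real.exp (-Λ * ‖z‖ ^ 2) * f z‖ + Real.exp (-Λ * ‖z‖ ^ 2) * |f y₀|)) =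
      η / 2 * (∫ z, mehlerProd ω q.1 q.2 z) + q.1 ^ 2 * C := by
    rw [integral_add hint hint', integral_const_mul, integral_const_mul]
  have hle : η / 2 * (∫ z, mehlerProd ω q.1 q.2 z) ≤ η / 2 * 1 := by
    gcongr
    exact integral_mehlerProd_le_one ω hτ0 q.2
  refine (le_of_eq hsum).trans_lt ?_
  linarith

lemma continuous_mehlerProd (ω : ι → ℝ) (τ : ℝ) :
    Continuous fun q : EuclideanSpace ℝ ι × EuclideanSpace ℝ ι => mehlerProd ω τ q.1 q.2 := by
  unfold mehlerProd mehler
  fun_prop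

/-- By Tonelli the Gaussian weight in `y` is integrated against the kernel first, and the result is
below the weight of the data. The constants do not depend on `τ` or `f`, as the density argument
needs. -/
lemma exists_lintegral_evolve_le (hω : ∀ i, 0 ≤ ω i) (T : ℝ) :
    ∃ ε > 0, ε ≤ 1 ∧ ∀ τ ∈ Ioc 0 T, ∀ f : EuclideanSpace ℝ ι → ℝ, AEStronglyMeasurable f →
      ∫⁻ y, ‖Real.exp (-gaussRate ω * ‖y‖ ^ 2) * evolve ω volume f τ y‖ₑ ≤
        ∫⁻ z, ‖weight ω ε z * f z‖ₑ := by
  obtain ⟨ε, hε, h⟩ := exists_integral_mehlerProd_mul_exp_le hω (gaussRate_pos hω).le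
    (lt_two_mul_gaussRate hω) T
  -- The bound `ε ≤ 1` ensures that the centred Gaussian of rate `gaussRate ω` lies below the
  -- weight.
  refine ⟨min ε 1, by positivity, min_le_right _ _, fun τ hτ f hf => ?_⟩
  set w : EuclideanSpace ℝ ι → ℝ := fun y => Real.exp (-gaussRate ω * ‖y‖ ^ 2)
  have hw : Continuous w := by fun_prop
  calc ∫⁻ y, ‖w y * evolve ω volume f τ y‖ₑ
      ≤ ∫⁻ y, ∫⁻ z, ‖mehlerProd ω τ y z * w y‖ₑ * ‖f z‖ₑ := by
        refine lintegral_mono fun y => ?_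
        rw [evolve, ← integral_const_mul]
        refine (enorm_integral_le_lintegral_enorm _).trans (le_of_eq (lintegral_congr fun z => ?_))
        rw [← enorm_mul]
        congr 1
        ring
    _ = ∫⁻ z, ∫⁻ y, ‖mehlerProd ω τ y z * w y‖ₑ * ‖f z‖ₑ := by
        refine lintegral_lintegral_swap ?_
        refine AEMeasurable.mul ?_ hf.comp_snd.enorm
        exact (((continuous_mehlerProd ω τ).mul (hw.comp continuous_fst)).enorm).aemeasurable
    _ ≤ ∫⁻ z, ‖weight ω (min ε 1) z * f z‖ₑ := by
        refine lintegral_mono fun z => ?_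
        have h1 : ∫⁻ y, ‖mehlerProd ω τ y z * w y‖ₑ = ENNReal.ofReal
            (∫ y, mehlerProd ω τ y z * w y) := by
          rw [ofReal_integral_eq_lintegral_ofReal
            (integrable_mehlerProd_mul_exp ω (gaussRate_pos hω).le hτ.1 z)
            (ae_of_all _ fun y => mul_nonneg (mehlerProd_pos ω hτ.1 y z).le (Real.exp_pos _).le)]
          exact lintegral_congr fun y => Real.enorm_of_nonneg
            (mul_nonneg (mehlerProd_pos ω hτ.1 y z).le (Real.exp_pos _).le)
        beta_reduce
        have hm : Measurable fun y => ‖mehlerProd ω τ y z * w y‖ₑ :=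
          (((continuous_mehlerProd ω τ).comp
            (Continuous.prodMk_left z)).mul hw).enorm.measurable
        rw [lintegral_mul_const _ hm, enorm_mul, h1,
          Real.enorm_of_nonneg (weight_pos _ _ _).le]
        gcongr
        exact (h τ hτ z).trans (weight_anti (min_le_left _ _) z)

lemma abs_evolve_le {C : ℝ} (hC : ∀ z, |f z| ≤ C) (hτ : 0 < τ) (y : EuclideanSpace ℝ ι) :
    |evolve ω volume f τ y| ≤ C := by
  have hC0 : 0 ≤ C := (abs_nonneg _).trans (hC 0)
  have h1 : ∀ z, ‖mehlerProd ω τ y z * f z‖ ≤ mehlerProd ω τ y z * C := fun z => by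
    rw [norm_mul, Real.norm_of_nonneg (mehlerProd_pos ω hτ y z).le]
    exact mul_le_mul_of_nonneg_left (hC z) (mehlerProd_pos ω hτ y z).le
  have h2 := norm_integral_le_of_norm_le ((integrable_mehlerProd ω hτ y).mul_const C)
    (ae_of_all _ h1)
  rw [integral_mul_const] at h2
  exact h2.trans (mul_le_of_le_one_left hC0 (integral_mehlerProd_le_one ω hτ y))

/-- Pointwise convergence is known from continuity, and mass at most 1 gives the dominating function
`2C` times a Gaussian. -/
lemma tendsto_lintegral_evolve_sub_of_hasCompactSupport (hω : ∀ i, 0 ≤ ω i) (hg : Continuous g)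
    (hc : HasCompactSupport g) :
    Tendsto (fun τ => ∫⁻ y, ‖Real.exp (-gaussRate ω * ‖y‖ ^ 2) *
      (evolve ω volume g τ y - g y)‖ₑ) (𝓝[>] 0) (𝓝 0) := by
  obtain ⟨C, hC⟩ := hg.bounded_above_of_compact_support hc
  have hadm := isAdmissible_of_hasCompactSupport (ω := ω) hg hc
  have hC0 : 0 ≤ C := (norm_nonneg _).trans (hC 0)
  have key := tendsto_lintegral_filter_of_dominated_convergence' (μ := volume) (l := 𝓝[>] (0 : ℝ))
    (F := fun τ y => ‖Real.exp (-gaussRate ω * ‖y‖ ^ 2) * (evolve ω volume g τ y - g y)‖ₑ)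
    (f := fun _ => 0)
    (fun y : EuclideanSpace ℝ ι => ‖Real.exp (-gaussRate ω * ‖y‖ ^ 2) * (2 * C)‖ₑ) ?_ ?_ ?_ ?_
  · simpa using key
  · filter_upwards [self_mem_nhdsWithin] with τ hτ
    have : Continuous (evolve ω volume g τ) :=
      (contDiff_slice (hadm.contDiffOn_evolve 0) hτ).continuous
    exact Continuous.aemeasurable (by fun_prop)
  · filter_upwards [self_mem_nhdsWithin] with τ hτ
    refine ae_of_all _ fun y => ?_
    rw [enorm_mul, enorm_mul]
    refine mul_le_mul_right ?_ _
    rw [enorm_le_iff_norm_le, Real.norm_of_nonneg (show 0 ≤ 2 * C by positivity)]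
    refine (norm_sub_le _ _).trans ?_
    have h1 := abs_evolve_le (ω := ω) hC hτ y
    have h2 := hC y
    rw [Real.norm_eq_abs]
    linarith
  · exact ((integrable_exp_neg_mul_norm_sq (gaussRate_pos hω)).mul_const (2 * C)).2.ne
  · refine ae_of_all _ fun y => ?_
    have h1 : Tendsto (fun τ : ℝ => (τ, y)) (𝓝[>] 0) (𝓝[>] 0 ×ˢ 𝓝 y) :=
      tendsto_id.prodMk tendsto_const_nhds
    have h2 := (hadm.tendsto_evolve hω (hg.continuousAt (x := y))).comp h1
    have h3 := ((h2.sub_const (g y)).const_mul (Real.exp (-gaussRate ω * ‖y‖ ^ 2))).enorm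
    simpa using h3

lemma IsAdmissible.sub (hf : IsAdmissible ω volume f) (hg : IsAdmissible ω volume g) :
    IsAdmissible ω volume fun z => f z - g z := fun ε hε => by
  simp only [mul_sub]
  exact (hf ε hε).sub (hg ε hε)

lemma IsAdmissible.evolve_sub (hf : IsAdmissible ω volume f) (hg : IsAdmissible ω volume g)
    (hτ : 0 < τ) (y : EuclideanSpace ℝ ι) :
    evolve ω volume (fun z => f z - g z) τ y = evolve ω volume f τ y - evolve ω volume g τ y := by
  unfold evolve
  rw [← integral_sub (hf.integrable_mehlerProd_mul hτ y) (hg.integrable_mehlerProd_mul hτ y)]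
  simp only [mul_sub]

/-- Strong continuity at time zero in a weighted `L¹` space. -/
lemma IsAdmissible.tendsto_lintegral_evolve_sub (hω : ∀ i, 0 ≤ ω i)
    (hf : IsAdmissible ω volume f) :
    Tendsto (fun τ => ∫⁻ y, ‖Real.exp (-gaussRate ω * ‖y‖ ^ 2) *
      (evolve ω volume f τ y - f y)‖ₑ) (𝓝[>] 0) (𝓝 0) := by
  rw [ENNReal.tendsto_nhds_zero]
  intro η hη
  obtain ⟨ε, hε, hε1, hL⟩ := exists_lintegral_evolve_le hω 1
  have hη3 : η / 3 ≠ 0 := (ENNReal.div_pos hη.ne' (by simp)).ne'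
  obtain ⟨h, hhc, hfh, hhcont, -⟩ := (hf ε hε).exists_hasCompactSupport_lintegral_sub_le hη3
  -- Density is applied to the integrable function `weight * f`; dividing the approximant by the
  -- weight keeps continuity and compact support.
  set g : EuclideanSpace ℝ ι → ℝ := fun z => (weight ω ε z)⁻¹ * h z with hg_def
  have hgcont : Continuous g :=
    ((continuous_weight ω ε).inv₀ fun z => (weight_pos ω ε z).ne').mul hhcont
  have hgc : HasCompactSupport g := hhc.mul_left
  have hg := isAdmissible_of_hasCompactSupport (ω := ω) hgcont hgc
  have hwfg : ∫⁻ z, ‖weight ω ε z * (f z - g z)‖ₑ ≤ η / 3 := by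
    refine le_trans (le_of_eq (lintegral_congr fun z => ?_)) hfh
    rw [mul_sub, hg_def]
    congr 2
    exact mul_inv_cancel_left₀ (weight_pos ω ε z).ne' _
  have hfg : ∫⁻ y, ‖Real.exp (-gaussRate ω * ‖y‖ ^ 2) * (f y - g y)‖ₑ ≤ η / 3 := by
    refine le_trans (lintegral_mono fun z => ?_) hwfg
    rw [enorm_mul, enorm_mul]
    gcongr
    rw [enorm_le_iff_norm_le, Real.norm_of_nonneg (Real.exp_pos _).le,
      Real.norm_of_nonneg (weight_pos _ _ _).le]
    exact exp_gaussRate_le_weight hω hε1 z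
  filter_upwards [self_mem_nhdsWithin,
    (ENNReal.tendsto_nhds_zero.1
      (tendsto_lintegral_evolve_sub_of_hasCompactSupport hω hgcont hgc)) (η / 3)
        (pos_iff_ne_zero.2 hη3),
    nhdsWithin_le_nhds (eventually_le_nhds (b := (1 : ℝ)) one_pos)] with τ hτ hτg hτ1
  have h1 := (hL τ ⟨hτ, hτ1⟩ _ (hf.sub hg).aestronglyMeasurable).trans hwfg
  have hcf : Continuous (evolve ω volume (fun z => f z - g z) τ) :=
    (contDiff_slice ((hf.sub hg).contDiffOn_evolve 0) hτ).continuous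
  have hcg : Continuous (evolve ω volume g τ) :=
    (contDiff_slice (hg.contDiffOn_evolve 0) hτ).continuous
  -- With `P` the evolution, `Pf - f = P(f - g) + (Pg - g) - (f - g)`.
  calc ∫⁻ y, ‖Real.exp (-gaussRate ω * ‖y‖ ^ 2) * (evolve ω volume f τ y - f y)‖ₑ
      ≤ ∫⁻ y, (‖Real.exp (-gaussRate ω * ‖y‖ ^ 2) *
          evolve ω volume (fun z => f z - g z) τ y‖ₑ +
        (‖Real.exp (-gaussRate ω * ‖y‖ ^ 2) * (evolve ω volume g τ y - g y)‖ₑ +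
        ‖Real.exp (-gaussRate ω * ‖y‖ ^ 2) * (f y - g y)‖ₑ)) := by
        refine lintegral_mono fun y => ?_
        have : Real.exp (-gaussRate ω * ‖y‖ ^ 2) * (evolve ω volume f τ y - f y) =
          Real.exp (-gaussRate ω * ‖y‖ ^ 2) * evolve ω volume (fun z => f z - g z) τ y +
          (Real.exp (-gaussRate ω * ‖y‖ ^ 2) * (evolve ω volume g τ y - g y) -
          Real.exp (-gaussRate ω * ‖y‖ ^ 2) * (f y - g y)) := by
          rw [hf.evolve_sub hg hτ]
          ring
        beta_reduce
        rw [this]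
        refine (enorm_add_le _ _).trans ?_
        gcongr
        exact enorm_sub_le
    _ ≤ η / 3 + (η / 3 + η / 3) := by
        rw [lintegral_add_left (Continuous.measurable (by fun_prop)),
          lintegral_add_left (Continuous.measurable (by fun_prop))]
        gcongr
    _ = η := by
        rw [← add_assoc, ENNReal.add_thirds]

/-- On a compact set the reciprocal of the Gaussian weight is bounded. -/
lemma IsAdmissible.tendsto_setLIntegral_evolve_sub (hω : ∀ i, 0 ≤ ω i)
    (hf : IsAdmissible ω volume f) {K : Set (EuclideanSpace ℝ ι)} (hK : IsCompact K) :
    Tendsto (fun τ => ∫⁻ y in K, ‖evolve ω volume f τ y - f y‖ₑ) (𝓝[>] 0) (𝓝 0) := by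
  obtain ⟨R, hR⟩ := hK.exists_bound_of_continuousOn
    (f := fun y : EuclideanSpace ℝ ι => Real.exp (gaussRate ω * ‖y‖ ^ 2))
    (Continuous.continuousOn (by fun_prop))
  have h := ENNReal.Tendsto.const_mul (a := ENNReal.ofReal R)
    (hf.tendsto_lintegral_evolve_sub hω) (Or.inr ENNReal.ofReal_ne_top)
  rw [mul_zero] at h
  refine tendsto_of_tendsto_of_tendsto_of_le_of_le tendsto_const_nhds h (fun _ => zero_le)
    fun τ => ?_
  beta_reduce
  rw [← lintegral_const_mul' _ _ ENNReal.ofReal_ne_top]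
  refine (setLIntegral_mono' hK.measurableSet fun y hy => ?_).trans (setLIntegral_le_lintegral K _)
  have h1 : evolve ω volume f τ y - f y = Real.exp (gaussRate ω * ‖y‖ ^ 2) *
      (Real.exp (-gaussRate ω * ‖y‖ ^ 2) * (evolve ω volume f τ y - f y)) := by
    rw [← mul_assoc, ← Real.exp_add, neg_mul, add_neg_cancel, Real.exp_zero, one_mul]
  nth_rw 1 [h1]
  rw [enorm_mul (Real.exp (gaussRate ω * ‖y‖ ^ 2))]
  gcongr
  rw [← ofReal_norm]
  exact ENNReal.ofReal_le_ofReal (hR y hy)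

lemma IsAdmissible.integrableOn_exp_mul_evolve (hω : ∀ i, 0 ≤ ω i)
    (hf : IsAdmissible ω volume f) (t₀ T : ℝ) :
    IntegrableOn (fun p : ℝ × EuclideanSpace ℝ ι =>
      Real.exp (-gaussRate ω * ‖p.2‖ ^ 2) * evolve ω volume f (p.1 - t₀) p.2)
        (Ioo t₀ T ×ˢ univ) := by
  obtain ⟨ε, hε, -, hL⟩ := exists_lintegral_evolve_le hω (T - t₀)
  have hcont : ContinuousOn (fun p : ℝ × EuclideanSpace ℝ ι =>
      Real.exp (-gaussRate ω * ‖p.2‖ ^ 2) * evolve ω volume f (p.1 - t₀) p.2)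
        (Ioo t₀ T ×ˢ univ) := by
    refine ContinuousOn.mul (Continuous.continuousOn (by fun_prop)) ?_
    exact (hf.contDiffOn_evolve 0).continuousOn.comp
      (f := fun p : ℝ × EuclideanSpace ℝ ι => (p.1 - t₀, p.2))
      (Continuous.continuousOn (by fun_prop)) fun p hp => ⟨sub_pos.2 hp.1.1, mem_univ _⟩
  have hm := hcont.aestronglyMeasurable (μ := volume) (measurableSet_Ioo.prod MeasurableSet.univ)
  refine ⟨hm, ?_⟩
  rw [Measure.volume_eq_prod, ← Measure.prod_restrict, Measure.restrict_univ] at hm ⊢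
  rw [HasFiniteIntegral, lintegral_prod _ hm.enorm]
  refine (setLIntegral_mono' (g := fun _ => ∫⁻ z, ‖weight ω ε z * f z‖ₑ) measurableSet_Ioo
    fun t ht => ?_).trans_lt ?_
  · exact hL (t - t₀) ⟨sub_pos.2 ht.1, by linarith [ht.2]⟩ f hf.aestronglyMeasurable
  · rw [setLIntegral_const, Real.volume_Ioo]
    exact ENNReal.mul_lt_top (hf ε hε).2 ENNReal.ofReal_lt_top

end InitialValue

/-! ### Integration by parts, commutators and cutoff functions. -/

section Derivatives

variable {ι : Type*} [Fintype ι] [DecidableEq ι]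

/-- The partial derivative in the direction of the `i`-th coordinate. -/
def partialDeriv (i : ι) (f : EuclideanSpace ℝ ι → ℝ) (y : EuclideanSpace ℝ ι) : ℝ :=
  fderiv ℝ f y (EuclideanSpace.single i 1)

section Calculus

variable {f g w v χ : EuclideanSpace ℝ ι → ℝ} {i : ι} {y : EuclideanSpace ℝ ι}

lemma laplacian_eq_sum_partialDeriv (hf : ContDiff ℝ 2 f) (y : EuclideanSpace ℝ ι) :
    Laplacian.laplacian f y = ∑ i, partialDeriv i (partialDeriv i f) y :=
  laplacian_eq_sum_fderiv
    (((hf.fderiv_right (m := 1) (by norm_num)).differentiable one_ne_zero) y)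

lemma ContDiff.partialDeriv {k m : WithTop ℕ∞} (hf : ContDiff ℝ m f) (hk : k + 1 ≤ m) (i : ι) :
    ContDiff ℝ k (partialDeriv i f) :=
  (hf.fderiv_right hk).clm_apply contDiff_const

lemma HasCompactSupport.partialDeriv (hf : HasCompactSupport f) (i : ι) :
    HasCompactSupport (partialDeriv i f) :=
  hf.fderiv_apply ℝ _

lemma partialDeriv_mul (hf : DifferentiableAt ℝ f y) (hg : DifferentiableAt ℝ g y) :
    partialDeriv i (fun x => f x * g x) y = f y * partialDeriv i g y + partialDeriv i f y * g y := by
  unfold partialDeriv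
  rw [fderiv_fun_mul hf hg]
  simp only [add_apply, smul_apply, smul_eq_mul]
  ring

lemma partialDeriv_add (hf : DifferentiableAt ℝ f y) (hg : DifferentiableAt ℝ g y) :
    partialDeriv i (fun x => f x + g x) y = partialDeriv i f y + partialDeriv i g y := by
  unfold partialDeriv
  rw [fderiv_fun_add hf hg, add_apply]

lemma integral_partialDeriv_mul (hf : ContDiff ℝ 1 f) (hg : ContDiff ℝ 1 g)
    (hc : HasCompactSupport g) (i : ι) :
    ∫ y, partialDeriv i f y * g y = -∫ y, f y * partialDeriv i g y := by
  have h := integral_mul_fderiv_eq_neg_fderiv_mul_of_integrable (μ := volume)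
    (f := f) (g := g) (v := EuclideanSpace.single i (1 : ℝ)) ?_ ?_ ?_ ?_ ?_
  · change ∫ y, f y * partialDeriv i g y = -∫ y, partialDeriv i f y * g y at h
    linarith
  · exact ((ContDiff.partialDeriv hf (k := 0) (by simp) i).continuous.mul
      hg.continuous).integrable_of_hasCompactSupport hc.mul_left
  · exact (hf.continuous.mul (ContDiff.partialDeriv hg (k := 0)
      (by simp) i).continuous).integrable_of_hasCompactSupport
        (HasCompactSupport.partialDeriv hc i).mul_left
  · exact (hf.continuous.mul hg.continuous).integrable_of_hasCompactSupport hc.mul_left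
  · exact fun x _ => hf.differentiable one_ne_zero x
  · exact fun x _ => hg.differentiable one_ne_zero x

lemma integral_laplacian_mul (hf : ContDiff ℝ 2 f) (hg : ContDiff ℝ 2 g)
    (hc : HasCompactSupport g) :
    ∫ y, Laplacian.laplacian f y * g y = ∫ y, f y * Laplacian.laplacian g y := by
  have hf1 : ∀ i, ContDiff ℝ 1 (partialDeriv i f) := ContDiff.partialDeriv hf (by norm_num)
  have hg1 : ∀ i, ContDiff ℝ 1 (partialDeriv i g) := ContDiff.partialDeriv hg (by norm_num)
  have hf2 : ∀ i, ContDiff ℝ 0 (partialDeriv i (partialDeriv i f)) := fun i =>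
    ContDiff.partialDeriv (hf1 i) (by simp) i
  have hg2 : ∀ i, ContDiff ℝ 0 (partialDeriv i (partialDeriv i g)) := fun i =>
    ContDiff.partialDeriv (hg1 i) (by simp) i
  simp_rw [laplacian_eq_sum_partialDeriv hf, laplacian_eq_sum_partialDeriv hg, Finset.sum_mul,
    Finset.mul_sum]
  rw [integral_finsetSum, integral_finsetSum]
  · refine Finset.sum_congr rfl fun i _ => ?_
    rw [integral_partialDeriv_mul (hf1 i) (hg.of_le (by norm_num)) hc,
      integral_partialDeriv_mul (hf.of_le (by norm_num)) (hg1 i)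
        (HasCompactSupport.partialDeriv hc i), neg_neg]
  · exact fun i _ => (hf.continuous.mul (hg2 i).continuous).integrable_of_hasCompactSupport
      (HasCompactSupport.partialDeriv (HasCompactSupport.partialDeriv hc i) i).mul_left
  · exact fun i _ => ((hf2 i).continuous.mul hg.continuous).integrable_of_hasCompactSupport
      hc.mul_left

/-- The commutator of the Laplacian with multiplication by `χ`, applied to `v`. -/
def laplacianCommutator (χ v : EuclideanSpace ℝ ι → ℝ) (y : EuclideanSpace ℝ ι) : ℝ :=
  ∑ i, (2 * partialDeriv i v y * partialDeriv i χ y + v y * partialDeriv i (partialDeriv i χ) y)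

lemma laplacian_mul (hv : ContDiff ℝ 2 v) (hχ : ContDiff ℝ 2 χ) (y : EuclideanSpace ℝ ι) :
    Laplacian.laplacian (fun x => v x * χ x) y =
      χ y * Laplacian.laplacian v y + laplacianCommutator χ v y := by
  have hv1 : ∀ i, ContDiff ℝ 1 (partialDeriv i v) := ContDiff.partialDeriv hv (by norm_num)
  have hχ1 : ∀ i, ContDiff ℝ 1 (partialDeriv i χ) := ContDiff.partialDeriv hχ (by norm_num)
  have dv := hv.differentiable two_ne_zero
  have dχ := hχ.differentiable two_ne_zero
  have dv1 := fun i => (hv1 i).differentiable one_ne_zero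
  have dχ1 := fun i => (hχ1 i).differentiable one_ne_zero
  rw [laplacian_eq_sum_partialDeriv (hv.mul hχ), laplacian_eq_sum_partialDeriv hv,
    laplacianCommutator, Finset.mul_sum, ← Finset.sum_add_distrib]
  refine Finset.sum_congr rfl fun i _ => ?_
  have h1 : partialDeriv i (fun x => v x * χ x) =
      fun x => v x * partialDeriv i χ x + partialDeriv i v x * χ x :=
    funext fun x => partialDeriv_mul (dv x) (dχ x)
  rw [h1, partialDeriv_add (f := fun x => v x * partialDeriv i χ x)
    (g := fun x => partialDeriv i v x * χ x) ((dv y).mul (dχ1 i y)) ((dv1 i y).mul (dχ y)),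
    partialDeriv_mul (dv y) (dχ1 i y), partialDeriv_mul (dv1 i y) (dχ y)]
  ring

/-- Testing `Δw` against `v χ` and moving the Laplacian over leaves the commutator. No derivative of
`w` survives, which matters because the growth hypothesis controls a solution but not its gradient.
-/
lemma integral_cutoff_mul_laplacian_sub (hw : ContDiff ℝ 2 w) (hv : ContDiff ℝ 2 v)
    (hχ : ContDiff ℝ 2 χ) (hc : HasCompactSupport χ) :
    ∫ y, χ y * (Laplacian.laplacian w y * v y - w y * Laplacian.laplacian v y) =
      ∫ y, w y * laplacianCommutator χ v y := by
  have hlap : ∀ {f : EuclideanSpace ℝ ι → ℝ}, ContDiff ℝ 2 f →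
      Continuous (Laplacian.laplacian f) := fun {f} hf => by
    rw [show Laplacian.laplacian f = fun y => ∑ i, partialDeriv i (partialDeriv i f) y from
      funext fun y => laplacian_eq_sum_partialDeriv hf y]
    exact continuous_finsetSum _ fun i _ =>
      (ContDiff.partialDeriv (ContDiff.partialDeriv hf (k := 1) (by norm_num) i) (k := 0)
        (by simp) i).continuous
  have h1 := integral_laplacian_mul hw (hv.mul hχ) hc.mul_left
  have hint1 : Integrable fun y => Laplacian.laplacian w y * (v y * χ y) :=
    ((hlap hw).mul (hv.continuous.mul hχ.continuous)).integrable_of_hasCompactSupport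
      hc.mul_left.mul_left
  have hint2 : Integrable fun y => w y * (χ y * Laplacian.laplacian v y) :=
    (hw.continuous.mul (hχ.continuous.mul (hlap hv))).integrable_of_hasCompactSupport
      hc.mul_right.mul_left
  have hint3 : Integrable fun y => w y * Laplacian.laplacian (fun x => v x * χ x) y := by
    refine (hw.continuous.mul (hlap (hv.mul hχ))).integrable_of_hasCompactSupport ?_
    refine (hc.mono' fun y hy => ?_).mul_left
    by_contra hy'
    refine hy ?_
    have h0 : (fun x => v x * χ x) =ᶠ[𝓝 y] fun _ => 0 := by
      filter_upwards [(isClosed_tsupport χ).isOpen_compl.mem_nhds hy'] with x hx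
      rw [image_eq_zero_of_notMem_tsupport hx, mul_zero]
    rw [(InnerProductSpace.laplacian_congr_nhds h0).eq_of_nhds]
    simp
  calc ∫ y, χ y * (Laplacian.laplacian w y * v y - w y * Laplacian.laplacian v y)
      = ∫ y, (Laplacian.laplacian w y * (v y * χ y) - w y * (χ y * Laplacian.laplacian v y)) := by
        congr 1
        ext y
        ring
    _ = ∫ y, (w y * Laplacian.laplacian (fun x => v x * χ x) y -
          w y * (χ y * Laplacian.laplacian v y)) := by
        rw [integral_sub hint1 hint2, integral_sub hint3 hint2, h1]
    _ = _ := by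
        congr 1
        ext y
        rw [laplacian_mul hv hχ]
        ring

lemma partialDeriv_comp_smul (c : ℝ) (f : EuclideanSpace ℝ ι → ℝ) (i : ι)
    (y : EuclideanSpace ℝ ι) :
    partialDeriv i (fun x => f (c • x)) y = c * partialDeriv i f (c • y) := by
  unfold partialDeriv
  rw [fderiv_comp_smul]
  simp

lemma partialDeriv_const_mul (c : ℝ) (f : EuclideanSpace ℝ ι → ℝ) (i : ι)
    (y : EuclideanSpace ℝ ι) :
    partialDeriv i (fun x => c * f x) y = c * partialDeriv i f y := by
  unfold partialDeriv
  have := congr_fun (fderiv_const_smul_field (𝕜 := ℝ) (f := f) c) y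
  simp only [Pi.smul_def, smul_eq_mul] at this
  simp [this]

/-- Smooth cutoff functions at scale `R` with derivatives bounded uniformly in `R ≥ 1`. -/
lemma exists_cutoff (ι : Type*) [Fintype ι] [DecidableEq ι] :
    ∃ C : ℝ, 0 ≤ C ∧ ∀ R : ℝ, 1 ≤ R → ∃ χ : EuclideanSpace ℝ ι → ℝ,
      ContDiff ℝ 2 χ ∧ HasCompactSupport χ ∧ (∀ y, ‖y‖ < R → χ y = 1) ∧ (∀ y, |χ y| ≤ 1) ∧
      (∀ i y, |partialDeriv i χ y| ≤ C) ∧ (∀ i y, |partialDeriv i (partialDeriv i χ) y| ≤ C) ∧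
      ∀ i y, ‖y‖ < R → partialDeriv i χ y = 0 ∧ partialDeriv i (partialDeriv i χ) y = 0 := by
  -- One bump function, rescaled by `R`: each derivative gains a factor `R⁻¹ ≤ 1`.
  let b : ContDiffBump (0 : EuclideanSpace ℝ ι) := ⟨1, 2, one_pos, one_lt_two⟩
  have hb : ContDiff ℝ 2 b := b.contDiff
  have hbc : HasCompactSupport b := b.hasCompactSupport
  have h1 : ∀ i, ContDiff ℝ 1 (partialDeriv i b) := ContDiff.partialDeriv hb (by norm_num)
  have h2 : ∀ i, ContDiff ℝ 0 (partialDeriv i (partialDeriv i b)) := fun i =>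
    ContDiff.partialDeriv (h1 i) (by simp) i
  have e1 := fun i => (h1 i).continuous.bounded_above_of_compact_support
    (HasCompactSupport.partialDeriv hbc i)
  have e2 := fun i => (h2 i).continuous.bounded_above_of_compact_support
    (HasCompactSupport.partialDeriv (HasCompactSupport.partialDeriv hbc i) i)
  choose C₁ hC₁ using e1
  choose C₂ hC₂ using e2
  have hC₁0 : ∀ i, 0 ≤ C₁ i := fun i => (norm_nonneg _).trans (hC₁ i 0)
  have hC₂0 : ∀ i, 0 ≤ C₂ i := fun i => (norm_nonneg _).trans (hC₂ i 0)
  have hsum : ∀ i, C₁ i ≤ ∑ j, (C₁ j + C₂ j) ∧ C₂ i ≤ ∑ j, (C₁ j + C₂ j) := fun i => by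
    have := Finset.single_le_sum (f := fun j => C₁ j + C₂ j)
      (fun j _ => add_nonneg (hC₁0 j) (hC₂0 j)) (Finset.mem_univ i)
    constructor <;> linarith [hC₁0 i, hC₂0 i]
  refine ⟨∑ j, (C₁ j + C₂ j), Finset.sum_nonneg fun j _ => add_nonneg (hC₁0 j) (hC₂0 j),
    fun R hR => ⟨fun y => b (R⁻¹ • y), ?_⟩⟩
  have hR0 : 0 < R := by linarith
  have hRinv : |R⁻¹| ≤ 1 := by
    rw [abs_of_pos (by positivity)]
    exact inv_le_one_of_one_le₀ hR
  have hD1 : ∀ i, partialDeriv i (fun y => b (R⁻¹ • y)) =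
      fun y => R⁻¹ * partialDeriv i b (R⁻¹ • y) := fun i =>
    funext fun y => partialDeriv_comp_smul _ _ _ _
  have hD2 : ∀ i y, partialDeriv i (partialDeriv i (fun y => b (R⁻¹ • y))) y =
      R⁻¹ * (R⁻¹ * partialDeriv i (partialDeriv i b) (R⁻¹ • y)) := fun i y => by
    rw [hD1, partialDeriv_const_mul, partialDeriv_comp_smul]
  have hone : ∀ y : EuclideanSpace ℝ ι, ‖y‖ < R → (fun y => b (R⁻¹ • y)) =ᶠ[𝓝 y] fun _ => 1 := by
    intro y hy
    filter_upwards [(isOpen_lt continuous_norm continuous_const).mem_nhds hy] with x hx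
    refine b.one_of_mem_closedBall ?_
    rw [mem_closedBall_zero_iff, norm_smul, norm_inv, Real.norm_of_nonneg hR0.le,
      inv_mul_le_iff₀ hR0, mul_one]
    exact hx.le
  have hz1 : ∀ i (y : EuclideanSpace ℝ ι), ‖y‖ < R →
      partialDeriv i (fun y => b (R⁻¹ • y)) y = 0 := fun i y hy => by
    rw [partialDeriv, (hone y hy).fderiv_eq]
    simp
  refine ⟨hb.comp (contDiff_const_smul _), ?_, fun y hy => (hone y hy).eq_of_nhds, fun y => ?_,
    fun i y => ?_, fun i y => ?_, fun i y hy => ⟨hz1 i y hy, ?_⟩⟩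
  · exact hbc.comp_homeomorph (Homeomorph.smulOfNeZero R⁻¹ (by positivity))
  · rw [abs_of_nonneg b.nonneg]
    exact b.le_one
  · rw [hD1]
    beta_reduce
    rw [abs_mul]
    exact (mul_le_of_le_one_left (abs_nonneg _) hRinv).trans ((hC₁ i _).trans (hsum i).1)
  · rw [hD2, abs_mul, abs_mul]
    exact (mul_le_of_le_one_left (by positivity) hRinv).trans
      ((mul_le_of_le_one_left (abs_nonneg _) hRinv).trans ((hC₂ i _).trans (hsum i).2))
  · have : partialDeriv i (fun y => b (R⁻¹ • y)) =ᶠ[𝓝 y] fun _ => 0 := by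
      filter_upwards [(isOpen_lt continuous_norm continuous_const).mem_nhds hy] with x hx
      exact hz1 i x hx
    rw [partialDeriv, this.fderiv_eq]
    simp

end Calculus

/-! ### The kernel as a solution, and its gradient bounds. -/

section KernelDerivatives

variable {ω : ι → ℝ} {τ : ℝ}

/-- Evolving a point mass yields the kernel itself, so its smoothness, equation and gradient are
instances of the results for `evolve`. -/
lemma isAdmissible_dirac (x : EuclideanSpace ℝ ι) :
    IsAdmissible ω (Measure.dirac x) fun _ => 1 := fun ε _ => by
  simp only [mul_one]
  exact (integrable_dirac (f := weight ω ε) (a := x) (by simp [enorm_lt_top]))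

lemma evolve_dirac (ω : ι → ℝ) (f : EuclideanSpace ℝ ι → ℝ) (τ : ℝ) (x y : EuclideanSpace ℝ ι) :
    evolve ω (Measure.dirac x) f τ y = mehlerProd ω τ y x * f x := by
  rw [evolve, integral_dirac]

lemma contDiffOn_mehlerProd (ω : ι → ℝ) (x : EuclideanSpace ℝ ι) (k : ℕ) :
    ContDiffOn ℝ k (fun q : ℝ × EuclideanSpace ℝ ι => mehlerProd ω q.1 q.2 x)
      (Ioi 0 ×ˢ univ) := by
  simpa only [evolve_dirac, mul_one] using
    (isAdmissible_dirac (ω := ω) x).contDiffOn_evolve k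

lemma contDiff_mehlerProd (ω : ι → ℝ) (hτ : 0 < τ) (x : EuclideanSpace ℝ ι) (k : ℕ) :
    ContDiff ℝ k fun y => mehlerProd ω τ y x :=
  contDiff_slice (U := fun τ y => mehlerProd ω τ y x) (contDiffOn_mehlerProd ω x k) hτ

lemma hasDerivAt_mehlerProd (ω : ι → ℝ) (hτ : 0 < τ) (x y : EuclideanSpace ℝ ι) :
    HasDerivAt (fun τ => mehlerProd ω τ y x)
      (Laplacian.laplacian (fun y => mehlerProd ω τ y x) y -
        (∑ i, ω i ^ 2 * y i ^ 2) * mehlerProd ω τ y x) τ := by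
  have h := (isAdmissible_dirac (ω := ω) x).hasDerivAt_evolve hτ y
  have he : evolve ω (Measure.dirac x) (fun _ => 1) τ = fun y => mehlerProd ω τ y x := by
    ext y
    rw [evolve_dirac, mul_one]
  rw [he] at h
  simpa only [evolve_dirac, mul_one] using h

lemma partialDeriv_mehlerProd (ω : ι → ℝ) (hτ : 0 < τ) (x y : EuclideanSpace ℝ ι) (i : ι) :
    partialDeriv i (fun y => mehlerProd ω τ y x) y =
      (-diagCoeff (ω i) τ * y i + crossCoeff (ω i) τ * x i) * mehlerProd ω τ y x := by
  have h := (isAdmissible_dirac (ω := ω) x).fderiv_evolve hτ y i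
  have he : evolve ω (Measure.dirac x) (fun _ => 1) τ = fun y => mehlerProd ω τ y x := by
    ext y
    rw [evolve_dirac, mul_one]
  rw [he] at h
  rw [partialDeriv, h, evolve_dirac]
  ring

/-- The coefficients of the logarithmic gradient are `O(1/τ)`; the factor `τ ^ 2` in the far-field
bound compensates for them. -/
lemma eventually_coeff_mul_le (ω : ℝ) :
    ∀ᶠ τ in 𝓝[>] (0 : ℝ), diagCoeff ω τ * τ ≤ 1 ∧ crossCoeff ω τ * τ ≤ 1 := by
  have hcosh : ∀ᶠ τ in 𝓝[>] (0 : ℝ), Real.cosh (2 * ω * τ) < 2 := by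
    have : Tendsto (fun τ => Real.cosh (2 * ω * τ)) (𝓝[>] 0) (𝓝 (Real.cosh (2 * ω * 0))) :=
      ((Real.continuous_cosh.comp (by fun_prop)).tendsto 0).mono_left nhdsWithin_le_nhds
    exact this.eventually_lt_const (by simp)
  filter_upwards [hcosh, self_mem_nhdsWithin] with τ hc hτ
  have hτ : 0 < τ := hτ
  have hw := two_mul_le_width ω hτ.le
  have hA : diagCoeff ω τ * τ ≤ 1 := by
    unfold diagCoeff
    rw [div_mul_eq_mul_div, div_le_one (width_pos ω hτ)]
    nlinarith
  exact ⟨hA, (mul_le_mul_of_nonneg_right (crossCoeff_le_diagCoeff ω hτ) hτ.le).trans hA⟩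

/-- For short times, the kernel and its gradient are below a Gaussian away from the pole. -/
lemma eventually_mehlerProd_and_partialDeriv_le (ω : ι → ℝ) (a : ℝ) :
    ∀ᶠ τ in 𝓝[>] (0 : ℝ), ∀ x y : EuclideanSpace ℝ ι, 2 * ‖x‖ + 1 ≤ ‖y‖ →
      |mehlerProd ω τ y x| ≤ Real.exp (-a * ‖y‖ ^ 2) ∧
      ∀ i, |partialDeriv i (fun y => mehlerProd ω τ y x) y| ≤ 2 * Real.exp (-a * ‖y‖ ^ 2) := by
  -- From `2‖x‖ + 1 ≤ ‖y‖` follows `‖x - y‖ ≥ (‖y‖ + 1)/2`, hence `c = 1/2`. The rate `a + 1` leaves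
  -- a factor `exp(-‖y‖²)` that absorbs the `‖y‖` from the gradient.
  filter_upwards [eventually_mehlerProd_le_of_far ω (c := 1 / 2) (by norm_num) (a + 1),
    eventually_all.2 fun i => eventually_coeff_mul_le (ω i), self_mem_nhdsWithin,
    nhdsWithin_le_nhds (eventually_le_nhds (b := (1 : ℝ)) one_pos)] with τ hK hco hτ hτ1 x y hxy
  have hτ : 0 < τ := hτ
  have hx := norm_nonneg x
  have hy := norm_nonneg y
  have htri : ‖y‖ - ‖x‖ ≤ ‖x - y‖ := by
    rw [norm_sub_rev]
    exact norm_sub_norm_le y x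
  have h1 := hK x y (by linarith) (by linarith)
  rw [mehlerProd_symm] at h1
  have h0 := mehlerProd_pos ω hτ y x
  have hexp : Real.exp (-(a + 1) * ‖y‖ ^ 2) =
      Real.exp (-a * ‖y‖ ^ 2) * Real.exp (-‖y‖ ^ 2) := by
    rw [← Real.exp_add]
    congr 1
    ring
  have hea := Real.exp_pos (-a * ‖y‖ ^ 2)
  have hy1 : Real.exp (-‖y‖ ^ 2) ≤ 1 := Real.exp_le_one_iff.2 (by nlinarith)
  have hy2 : ‖y‖ * Real.exp (-‖y‖ ^ 2) ≤ 1 := by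
    rw [Real.exp_neg, ← div_eq_mul_inv, div_le_one (Real.exp_pos _)]
    have := Real.add_one_le_exp (‖y‖ ^ 2)
    nlinarith [sq_nonneg (‖y‖ - 1)]
  refine ⟨?_, fun i => ?_⟩
  · rw [abs_of_pos h0]
    refine h1.trans ?_
    rw [hexp]
    calc τ ^ 2 * (Real.exp (-a * ‖y‖ ^ 2) * Real.exp (-‖y‖ ^ 2))
        ≤ 1 * (Real.exp (-a * ‖y‖ ^ 2) * 1) := by
          gcongr
          exact pow_le_one₀ hτ.le hτ1
      _ = _ := by ring
  · rw [partialDeriv_mehlerProd ω hτ, abs_mul, abs_of_pos h0]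
    have hB := crossCoeff_pos (ω i) hτ
    have hA := hB.le.trans (crossCoeff_le_diagCoeff (ω i) hτ)
    have hyi : |y i| ≤ ‖y‖ := PiLp.norm_apply_le y i
    have hxi : |x i| ≤ ‖y‖ := (PiLp.norm_apply_le x i).trans (by linarith)
    have h2 : |-diagCoeff (ω i) τ * y i + crossCoeff (ω i) τ * x i| * τ ≤ 2 * ‖y‖ := by
      have h3 : |-diagCoeff (ω i) τ * y i + crossCoeff (ω i) τ * x i| ≤
          diagCoeff (ω i) τ * ‖y‖ + crossCoeff (ω i) τ * ‖y‖ := by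
        refine (abs_add_le _ _).trans ?_
        rw [abs_mul, abs_mul, abs_neg, abs_of_nonneg hA, abs_of_pos hB]
        gcongr
      nlinarith [mul_le_mul_of_nonneg_right h3 hτ.le,
        mul_le_mul_of_nonneg_right (hco i).1 hy, mul_le_mul_of_nonneg_right (hco i).2 hy]
    calc |-diagCoeff (ω i) τ * y i + crossCoeff (ω i) τ * x i| * mehlerProd ω τ y x
        ≤ |-diagCoeff (ω i) τ * y i + crossCoeff (ω i) τ * x i| *
          (τ ^ 2 * Real.exp (-(a + 1) * ‖y‖ ^ 2)) := by gcongr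
      _ = |-diagCoeff (ω i) τ * y i + crossCoeff (ω i) τ * x i| * τ * τ *
          (Real.exp (-a * ‖y‖ ^ 2) * Real.exp (-‖y‖ ^ 2)) := by
          rw [hexp]
          ring
      _ ≤ 2 * ‖y‖ * 1 * (Real.exp (-a * ‖y‖ ^ 2) * Real.exp (-‖y‖ ^ 2)) := by
          gcongr
      _ = 2 * Real.exp (-a * ‖y‖ ^ 2) * (‖y‖ * Real.exp (-‖y‖ ^ 2)) := by ring
      _ ≤ 2 * Real.exp (-a * ‖y‖ ^ 2) * 1 := by gcongr
      _ = _ := by ring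

end KernelDerivatives

end Derivatives

/-! ### Uniqueness in the class of Gaussian growth. -/

section Uniqueness

variable {n : ℕ} {d ω : Fin n → ℝ} {t₀ T : ℝ} {η₀ : EuclideanSpace ℝ (Fin n) → ℝ}
  {W : ℝ → EuclideanSpace ℝ (Fin n) → ℝ} {χ : EuclideanSpace ℝ (Fin n) → ℝ}

lemma continuousOn_laplacian {U : ℝ → EuclideanSpace ℝ (Fin n) → ℝ}
    {s : Set (ℝ × EuclideanSpace ℝ (Fin n))}
    (hU : ContinuousOn
      (fun p : ℝ × EuclideanSpace ℝ (Fin n) => fderiv ℝ (fderiv ℝ (U p.1)) p.2) s) :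
    ContinuousOn (fun p : ℝ × EuclideanSpace ℝ (Fin n) => Laplacian.laplacian (U p.1) p.2) s := by
  simp_rw [laplacian_eq_sum_fderiv_fderiv]
  exact continuousOn_finsetSum _ fun i _ =>
    (hU.clm_apply continuousOn_const).clm_apply continuousOn_const

lemma contDiffOn_mehlerProd_sub (ω : Fin n → ℝ) (x : EuclideanSpace ℝ (Fin n)) (β : ℝ) (k : ℕ) :
    ContDiffOn ℝ k (fun q : ℝ × EuclideanSpace ℝ (Fin n) => mehlerProd ω (β - q.1) q.2 x)
      (Iio β ×ˢ univ) :=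
  (contDiffOn_mehlerProd ω x k).comp
    (f := fun q : ℝ × EuclideanSpace ℝ (Fin n) => (β - q.1, q.2))
    (ContDiff.contDiffOn (by fun_prop)) fun q hq => ⟨show 0 < β - q.1 from sub_pos.2 hq.1, mem_univ _⟩

lemma continuousOn_laplacian_mehlerProd_sub (ω : Fin n → ℝ) (x : EuclideanSpace ℝ (Fin n))
    (β : ℝ) :
    ContinuousOn (fun p : ℝ × EuclideanSpace ℝ (Fin n) =>
      Laplacian.laplacian (fun y => mehlerProd ω (β - p.1) y x) p.2) (Iio β ×ˢ univ) := by
  have h1 := contDiffOn_fderiv_snd (U := fun s y => mehlerProd ω (β - s) y x) (k := 1) isOpen_Iio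
    (contDiffOn_mehlerProd_sub ω x β 2) (by norm_num)
  have h2 := contDiffOn_fderiv_snd (U := fun s y => fderiv ℝ (fun y => mehlerProd ω (β - s) y x) y)
    (k := 0) isOpen_Iio h1 (by simp)
  exact continuousOn_laplacian (U := fun s y => mehlerProd ω (β - s) y x) h2.continuousOn

/-- Green's identity for a solution, the backward kernel and a cutoff function. -/
lemma IsIVPSolution.integral_cutoff_sub (hW : IsIVPSolution d t₀ T η₀ W)
    (hω : ∀ i, ω i ^ 2 = d i) {a b β : ℝ} (ha : t₀ < a) (hab : a ≤ b) (hb : b < T) (hβ : b < β)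
    (x : EuclideanSpace ℝ (Fin n)) (hχ : ContDiff ℝ 2 χ) (hc : HasCompactSupport χ) :
    (∫ y, χ y * (W b y * mehlerProd ω (β - b) y x)) -
      ∫ y, χ y * (W a y * mehlerProd ω (β - a) y x) =
    ∫ s in a..b, ∫ y, W s y * laplacianCommutator χ (fun y => mehlerProd ω (β - s) y x) y := by
  have hI : ∀ s ∈ Icc a b, s ∈ Ioo t₀ T := fun s hs => ⟨ha.trans_le hs.1, hs.2.trans_lt hb⟩
  have hIβ : ∀ s ∈ Icc a b, s < β := fun s hs => hs.2.trans_lt hβ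
  set F : ℝ → EuclideanSpace ℝ (Fin n) → ℝ := fun s y =>
    Laplacian.laplacian (W s) y * mehlerProd ω (β - s) y x -
      W s y * Laplacian.laplacian (fun y => mehlerProd ω (β - s) y x) y with hF
  have hFcont : ContinuousOn (fun p : ℝ × EuclideanSpace ℝ (Fin n) => F p.1 p.2)
      (Icc a b ×ˢ univ) := by
    have s1 : Icc a b ×ˢ (univ : Set (EuclideanSpace ℝ (Fin n))) ⊆ Ioo t₀ T ×ˢ univ :=
      prod_mono hI le_rfl
    have s2 : Icc a b ×ˢ (univ : Set (EuclideanSpace ℝ (Fin n))) ⊆ Iio β ×ˢ univ :=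
      prod_mono hIβ le_rfl
    exact (((continuousOn_laplacian hW.continuousOn_fderiv_fderiv).mono s1).mul
      ((contDiffOn_mehlerProd_sub ω x β 0).continuousOn.mono s2)).sub
        ((hW.continuousOn.mono s1).mul ((continuousOn_laplacian_mehlerProd_sub ω x β).mono s2))
  -- The solution runs forward and the kernel backward in `s`, so the potential terms cancel in the
  -- derivative of the product.
  have hderiv : ∀ y, ∀ s ∈ Icc a b,
      HasDerivAt (fun s => W s y * mehlerProd ω (β - s) y x) (F s y) s := fun y s hs => by
    have h1 := (hasDerivAt_mehlerProd ω (sub_pos.2 (hIβ s hs)) x y).comp s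
      ((hasDerivAt_id s).const_sub β)
    refine ((hW.pde s (hI s hs) y).mul h1).congr_deriv ?_
    simp only [hF, hω, Function.comp_apply]
    ring
  have hFTC : ∀ y, ∫ s in a..b, χ y * F s y =
      χ y * (W b y * mehlerProd ω (β - b) y x) - χ y * (W a y * mehlerProd ω (β - a) y x) := by
    intro y
    rw [intervalIntegral.integral_const_mul, intervalIntegral.integral_eq_sub_of_hasDerivAt
      (f := fun s => W s y * mehlerProd ω (β - s) y x)
      (fun s hs => hderiv y s (by rwa [uIcc_of_le hab] at hs)), mul_sub]
    refine ContinuousOn.intervalIntegrable ?_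
    rw [uIcc_of_le hab]
    exact hFcont.comp (f := fun s : ℝ => (s, y)) (Continuous.continuousOn (by fun_prop))
      fun s hs => ⟨hs, mem_univ _⟩
  have hWc : ∀ s ∈ Icc a b, Integrable fun y => χ y * (W s y * mehlerProd ω (β - s) y x) :=
    fun s hs => (hχ.continuous.mul ((hW.contDiff_space s (hI s hs)).continuous.mul
      (contDiff_mehlerProd ω (sub_pos.2 (hIβ s hs)) x 0).continuous)).integrable_of_hasCompactSupport
        hc.mul_right
  have hint : Integrable (Function.uncurry fun s y => χ y * F s y)
      ((volume.restrict (uIoc a b)).prod volume) := by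
    have h1 : IntegrableOn (Function.uncurry fun s y => χ y * F s y)
        (Icc a b ×ˢ tsupport χ) (volume.prod volume) := by
      refine ContinuousOn.integrableOn_compact (isCompact_Icc.prod hc) ?_
      exact (hχ.continuous.comp continuous_snd).continuousOn.mul
        (hFcont.mono (prod_mono le_rfl (subset_univ _)))
    have h2 : IntegrableOn (Function.uncurry fun s y => χ y * F s y)
        (Icc a b ×ˢ univ) (volume.prod volume) := by
      refine h1.of_forall_sdiff_eq_zero (measurableSet_Icc.prod MeasurableSet.univ) fun p hp => ?_
      have hp2 : p.2 ∉ tsupport χ := fun h => hp.2 ⟨hp.1.1, h⟩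
      simp [Function.uncurry, image_eq_zero_of_notMem_tsupport hp2]
    have h3 := h2.mono_set (prod_mono (show uIoc a b ⊆ Icc a b by
      rw [uIoc_of_le hab]; exact Ioc_subset_Icc_self) le_rfl)
    rwa [IntegrableOn, ← Measure.prod_restrict, Measure.restrict_univ] at h3
  rw [← integral_sub (hWc b ⟨hab, le_rfl⟩) (hWc a ⟨le_rfl, hab⟩)]
  simp_rw [← hFTC]
  rw [← intervalIntegral_integral_swap hint]
  refine intervalIntegral.integral_congr fun s hs => ?_
  rw [uIcc_of_le hab] at hs
  exact integral_cutoff_mul_laplacian_sub (hW.contDiff_space s (hI s hs))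
    (contDiff_mehlerProd ω (sub_pos.2 (hIβ s hs)) x 2) hχ hc

/-- The short-time bounds on the kernel which enter the uniqueness proof, with rate `a`. -/
def KernelBounds (ω : Fin n → ℝ) (a τ : ℝ) : Prop :=
  0 < τ ∧ (∀ y z : EuclideanSpace ℝ (Fin n),
    mehlerProd ω τ y z ≤ τ⁻¹ ^ Fintype.card (Fin n) * Real.exp (-(‖y - z‖ ^ 2 / (8 * τ)))) ∧
  ∀ x y : EuclideanSpace ℝ (Fin n), 2 * ‖x‖ + 1 ≤ ‖y‖ →
    |mehlerProd ω τ y x| ≤ Real.exp (-a * ‖y‖ ^ 2) ∧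
    ∀ i, |partialDeriv i (fun y => mehlerProd ω τ y x) y| ≤ 2 * Real.exp (-a * ‖y‖ ^ 2)

lemma exists_kernelBounds (ω : Fin n → ℝ) (a : ℝ) :
    ∃ h > 0, ∀ τ ∈ Ioo 0 h, KernelBounds ω a τ :=
  mem_nhdsGT_iff_exists_Ioo_subset.1 (inter_mem self_mem_nhdsWithin
    (inter_mem (eventually_mehlerProd_le ω) (eventually_mehlerProd_and_partialDeriv_le ω a)))

lemma KernelBounds.abs_laplacianCommutator_le {a τ C R : ℝ} (hk : KernelBounds ω a τ)
    {x : EuclideanSpace ℝ (Fin n)} (hR : 2 * ‖x‖ + 1 ≤ R)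
    (h1 : ∀ i y, |partialDeriv i χ y| ≤ C) (h2 : ∀ i y, |partialDeriv i (partialDeriv i χ) y| ≤ C)
    {y : EuclideanSpace ℝ (Fin n)} (hy : R ≤ ‖y‖) :
    |laplacianCommutator χ (fun y => mehlerProd ω τ y x) y| ≤
      n * (5 * C) * Real.exp (-a * ‖y‖ ^ 2) := by
  obtain ⟨k0, k1⟩ := hk.2.2 x y (hR.trans hy)
  unfold laplacianCommutator
  refine (Finset.abs_sum_le_sum_abs _ _).trans ?_
  have hi : ∀ i ∈ Finset.univ, |2 * partialDeriv i (fun y => mehlerProd ω τ y x) y *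
      partialDeriv i χ y + mehlerProd ω τ y x * partialDeriv i (partialDeriv i χ) y| ≤
      5 * C * Real.exp (-a * ‖y‖ ^ 2) := fun i _ => by
    refine (abs_add_le _ _).trans ?_
    rw [abs_mul, abs_mul, abs_mul, abs_two]
    have := mul_le_mul (k1 i) (h1 i y) (abs_nonneg _) (by positivity)
    have := mul_le_mul k0 (h2 i y) (abs_nonneg _) (by positivity)
    linarith
  refine (Finset.sum_le_sum hi).trans (le_of_eq ?_)
  rw [Finset.sum_const, Finset.card_univ, Fintype.card_fin, nsmul_eq_mul]
  ring

lemma laplacianCommutator_eq_zero {v : EuclideanSpace ℝ (Fin n) → ℝ}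
    {y : EuclideanSpace ℝ (Fin n)}
    (h : ∀ i, partialDeriv i χ y = 0 ∧ partialDeriv i (partialDeriv i χ) y = 0) :
    laplacianCommutator χ v y = 0 := by
  unfold laplacianCommutator
  exact Finset.sum_eq_zero fun i _ => by rw [(h i).1, (h i).2, mul_zero, mul_zero, add_zero]

/-- Convergence in `L¹_loc` suffices since the cutoff has compact support and the kernel stays
bounded near the initial time. -/
lemma IsIVPSolution.tendsto_integral_cutoff (hW : IsIVPSolution d t₀ T (fun _ => 0) W)
    {b β M : ℝ} (hb : t₀ < b) (x : EuclideanSpace ℝ (Fin n)) (hc : HasCompactSupport χ)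
    (h1 : ∀ y, |χ y| ≤ 1) (hM : ∀ s ∈ Ioo t₀ b, ∀ y, |mehlerProd ω (β - s) y x| ≤ M) :
    Tendsto (fun s => ‖∫ y, χ y * (W s y * mehlerProd ω (β - s) y x)‖ₑ) (𝓝[>] t₀) (𝓝 0) := by
  have h := ENNReal.Tendsto.mul_const (b := ENNReal.ofReal M) (hW.initial (tsupport χ) hc)
    (Or.inr ENNReal.ofReal_ne_top)
  rw [zero_mul] at h
  refine tendsto_of_tendsto_of_tendsto_of_le_of_le' tendsto_const_nhds h
    (Eventually.of_forall fun _ => zero_le) ?_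
  filter_upwards [Ioo_mem_nhdsGT hb] with s hs
  refine (enorm_integral_le_lintegral_enorm _).trans ?_
  rw [← lintegral_mul_const' _ _ ENNReal.ofReal_ne_top,
    ← lintegral_indicator (isClosed_tsupport χ).measurableSet]
  refine lintegral_mono fun y => ?_
  by_cases hy : y ∈ tsupport χ
  · rw [indicator_of_mem hy, enorm_mul, enorm_mul, sub_zero]
    have e1 : ‖χ y‖ₑ ≤ 1 := by
      rw [← enorm_one (G := ℝ), enorm_le_iff_norm_le, norm_one]
      exact h1 y
    have e2 : ‖mehlerProd ω (β - s) y x‖ₑ ≤ ENNReal.ofReal M := by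
      rw [← ofReal_norm]
      exact ENNReal.ofReal_le_ofReal (hM s hs y)
    calc ‖χ y‖ₑ * (‖W s y‖ₑ * ‖mehlerProd ω (β - s) y x‖ₑ)
        ≤ 1 * (‖W s y‖ₑ * ENNReal.ofReal M) := by gcongr
      _ = _ := one_mul _
  · rw [indicator_of_notMem hy, image_eq_zero_of_notMem_tsupport hy, zero_mul, enorm_zero]

/-- Letting the lower time in Green's identity tend to `t₀` removes the initial term. The commutator
lives on `‖y‖ ≥ R`, where the short-time bounds replace the kernel and its gradient by the Gaussian
weight of the growth hypothesis. -/
lemma IsIVPSolution.enorm_integral_cutoff_le (hW : IsIVPSolution d t₀ T (fun _ => 0) W)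
    (hω : ∀ i, ω i ^ 2 = d i) {a b h τ C R : ℝ}
    (hint : IntegrableOn (fun p : ℝ × EuclideanSpace ℝ (Fin n) =>
      Real.exp (-a * ‖p.2‖ ^ 2) * W p.1 p.2) (Ioo t₀ T ×ˢ univ))
    (hk : ∀ τ ∈ Ioo 0 h, KernelBounds ω a τ) (hb : b ∈ Ioo t₀ T) (hτ : 0 < τ)
    (hbτ : b - t₀ + τ < h) {x : EuclideanSpace ℝ (Fin n)} (hR : 2 * ‖x‖ + 1 ≤ R)
    (hχ : ContDiff ℝ 2 χ) (hc : HasCompactSupport χ) (hχ1 : ∀ y, |χ y| ≤ 1)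
    (h1 : ∀ i y, |partialDeriv i χ y| ≤ C) (h2 : ∀ i y, |partialDeriv i (partialDeriv i χ) y| ≤ C)
    (h3 : ∀ i y, ‖y‖ < R → partialDeriv i χ y = 0 ∧ partialDeriv i (partialDeriv i χ) y = 0) :
    ‖∫ y, χ y * (W b y * mehlerProd ω τ y x)‖ₑ ≤ ENNReal.ofReal (n * (5 * C)) *
      ∫⁻ p in Ioo t₀ T ×ˢ {y : EuclideanSpace ℝ (Fin n) | R ≤ ‖y‖},
        ‖Real.exp (-a * ‖p.2‖ ^ 2) * W p.1 p.2‖ₑ := by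
  -- The pole lies `τ` after `b`, so the age `β - s` of the kernel stays in `[τ, h)`: away from its
  -- singularity and within the range of the short-time bounds.
  set β := b + τ with hβ
  have hτβ : β - b = τ := by rw [hβ]; ring
  have hmem : ∀ s ∈ Ioc t₀ b, β - s ∈ Ioo 0 h := fun s hs =>
    ⟨by linarith [hs.2], by linarith [hs.1]⟩
  have hM : ∀ s ∈ Ioo t₀ b, ∀ y : EuclideanSpace ℝ (Fin n),
      |mehlerProd ω (β - s) y x| ≤ τ⁻¹ ^ Fintype.card (Fin n) := fun s hs y => by
    obtain ⟨k0, k1, -⟩ := hk _ (hmem s ⟨hs.1, hs.2.le⟩)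
    rw [abs_of_pos (mehlerProd_pos ω k0 y x)]
    refine (k1 y x).trans ?_
    have e1 : Real.exp (-(‖y - x‖ ^ 2 / (8 * (β - s)))) ≤ 1 :=
      Real.exp_le_one_iff.2 (neg_nonpos.2 (by positivity))
    have e2 : (β - s)⁻¹ ≤ τ⁻¹ := inv_anti₀ hτ (by linarith [hs.2])
    calc (β - s)⁻¹ ^ Fintype.card (Fin n) * Real.exp (-(‖y - x‖ ^ 2 / (8 * (β - s))))
        ≤ τ⁻¹ ^ Fintype.card (Fin n) * 1 := by gcongr
      _ = _ := mul_one _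
  have hlim := (hW.tendsto_integral_cutoff hb.1 x hc hχ1 hM).add_const
    (ENNReal.ofReal (n * (5 * C)) *
      ∫⁻ p in Ioo t₀ T ×ˢ {y : EuclideanSpace ℝ (Fin n) | R ≤ ‖y‖},
        ‖Real.exp (-a * ‖p.2‖ ^ 2) * W p.1 p.2‖ₑ)
  rw [zero_add] at hlim
  refine ge_of_tendsto hlim ?_
  filter_upwards [Ioo_mem_nhdsGT hb.1] with s hs
  have hid := hW.integral_cutoff_sub hω hs.1 hs.2.le hb.2 (show b < β by linarith) x hχ hc
  rw [hτβ] at hid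
  rw [sub_eq_iff_eq_add'.1 hid]
  refine (enorm_add_le _ _).trans ?_
  gcongr
  have hset : MeasurableSet {y : EuclideanSpace ℝ (Fin n) | R ≤ ‖y‖} :=
    measurableSet_le measurable_const measurable_norm
  have hm : AEMeasurable (fun p : ℝ × EuclideanSpace ℝ (Fin n) =>
      ‖Real.exp (-a * ‖p.2‖ ^ 2) * W p.1 p.2‖ₑ) ((volume.restrict (Ioo t₀ T)).prod
        (volume.restrict {y | R ≤ ‖y‖})) := by
    rw [Measure.prod_restrict]
    exact (hint.mono_set (prod_mono le_rfl (subset_univ _))).aestronglyMeasurable.enorm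
  rw [Measure.volume_eq_prod, ← Measure.prod_restrict, lintegral_prod _ hm,
    ← lintegral_const_mul' _ _ ENNReal.ofReal_ne_top, intervalIntegral.integral_of_le hs.2.le]
  refine (enorm_integral_le_lintegral_enorm _).trans ?_
  have hsub : Ioc s b ⊆ Ioo t₀ T := fun r hr => ⟨hs.1.trans hr.1, hr.2.trans_lt hb.2⟩
  refine le_trans ?_ (lintegral_mono_set hsub)
  refine setLIntegral_mono' measurableSet_Ioc fun r hr => ?_
  refine (enorm_integral_le_lintegral_enorm _).trans ?_
  rw [← lintegral_const_mul' _ _ ENNReal.ofReal_ne_top, ← lintegral_indicator hset]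
  refine lintegral_mono fun y => ?_
  by_cases hy : R ≤ ‖y‖
  · rw [indicator_of_mem (show y ∈ {y | R ≤ ‖y‖} from hy), mul_comm (Real.exp _), enorm_mul,
      enorm_mul, ← mul_assoc, mul_comm _ (‖W r y‖ₑ), mul_assoc]
    gcongr
    have hpos := Real.exp_pos (-a * ‖y‖ ^ 2)
    rw [Real.enorm_of_nonneg hpos.le, ← ENNReal.ofReal_mul' hpos.le, ← ofReal_norm]
    exact ENNReal.ofReal_le_ofReal
      ((hk _ (hmem r ⟨hs.1.trans hr.1, hr.2⟩)).abs_laplacianCommutator_le hR h1 h2 hy)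
  · rw [laplacianCommutator_eq_zero fun i => h3 i y (not_le.1 hy), mul_zero, enorm_zero]
    exact zero_le

/-- A solution with zero initial value and Gaussian growth vanishes for a short time. -/
lemma IsIVPSolution.eq_zero_of_sub_lt (hW : IsIVPSolution d t₀ T (fun _ => 0) W)
    (hω0 : ∀ i, 0 ≤ ω i) (hω : ∀ i, ω i ^ 2 = d i) {a b h : ℝ}
    (hint : IntegrableOn (fun p : ℝ × EuclideanSpace ℝ (Fin n) =>
      Real.exp (-a * ‖p.2‖ ^ 2) * W p.1 p.2) (Ioo t₀ T ×ˢ univ))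
    (hk : ∀ τ ∈ Ioo 0 h, KernelBounds ω a τ) (hb : b ∈ Ioo t₀ T) (hbh : b - t₀ < h)
    (x : EuclideanSpace ℝ (Fin n)) : W b x = 0 := by
  obtain ⟨C, hC, hcut⟩ := exists_cutoff (Fin n)
  -- The bound is uniform in `τ`, and as `τ ↓ 0` the kernel integral of `χ * W b` recovers `W b x`,
  -- because `χ x = 1`.
  have hbound : ∀ R : ℝ, 2 * ‖x‖ + 1 ≤ R → ‖W b x‖ₑ ≤ ENNReal.ofReal (n * (5 * C)) *
      ∫⁻ p in Ioo t₀ T ×ˢ {y : EuclideanSpace ℝ (Fin n) | R ≤ ‖y‖},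
        ‖Real.exp (-a * ‖p.2‖ ^ 2) * W p.1 p.2‖ₑ := fun R hR => by
    have hx := norm_nonneg x
    obtain ⟨χ, hχ, hc, hone, hle, h1, h2, h3⟩ := hcut R (by linarith)
    have hcont : Continuous fun y => χ y * W b y :=
      hχ.continuous.mul (hW.contDiff_space b hb).continuous
    have hadm := isAdmissible_of_hasCompactSupport (ω := ω) hcont hc.mul_right
    have hlim : Tendsto (fun τ => ‖evolve ω volume (fun y => χ y * W b y) τ x‖ₑ) (𝓝[>] 0)
        (𝓝 ‖W b x‖ₑ) := by
      have e1 : Tendsto (fun τ : ℝ => (τ, x)) (𝓝[>] 0) (𝓝[>] 0 ×ˢ 𝓝 x) :=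
        tendsto_id.prodMk tendsto_const_nhds
      have e2 := ((hadm.tendsto_evolve hω0 hcont.continuousAt).comp e1).enorm
      rwa [hone x (by linarith), one_mul] at e2
    refine le_of_tendsto hlim ?_
    filter_upwards [Ioo_mem_nhdsGT (sub_pos.2 hbh)] with τ hτ
    refine le_trans (le_of_eq ?_) (hW.enorm_integral_cutoff_le hω hint hk hb hτ.1
      (by linarith [hτ.2]) hR hχ hc hle h1 h2 h3)
    rw [evolve]
    congr 2
    ext y
    rw [mehlerProd_symm]
    ring
  have htail : Tendsto (fun k : ℕ =>
      ∫⁻ p in Ioo t₀ T ×ˢ {y : EuclideanSpace ℝ (Fin n) | (k : ℝ) ≤ ‖y‖},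
        ‖Real.exp (-a * ‖p.2‖ ^ 2) * W p.1 p.2‖ₑ) atTop (𝓝 0) := by
    have hsm : ∀ k : ℕ, MeasurableSet
        (Ioo t₀ T ×ˢ {y : EuclideanSpace ℝ (Fin n) | (k : ℝ) ≤ ‖y‖}) := fun k =>
      measurableSet_Ioo.prod (measurableSet_le measurable_const measurable_norm)
    have hi : ∀ k : ℕ, IntegrableOn (fun p : ℝ × EuclideanSpace ℝ (Fin n) =>
        Real.exp (-a * ‖p.2‖ ^ 2) * W p.1 p.2)
        (Ioo t₀ T ×ˢ {y : EuclideanSpace ℝ (Fin n) | (k : ℝ) ≤ ‖y‖}) := fun k =>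
      hint.mono_set (prod_mono le_rfl (subset_univ _))
    have hanti : Antitone fun k : ℕ =>
        Ioo t₀ T ×ˢ {y : EuclideanSpace ℝ (Fin n) | (k : ℝ) ≤ ‖y‖} := fun k l hkl =>
      prod_mono le_rfl fun y (hy : (l : ℝ) ≤ ‖y‖) => (Nat.cast_le.2 hkl).trans hy
    have hempty : ⋂ k : ℕ, Ioo t₀ T ×ˢ {y : EuclideanSpace ℝ (Fin n) | (k : ℝ) ≤ ‖y‖} = ∅ := by
      refine eq_empty_of_forall_notMem fun p hp => ?_
      obtain ⟨k, hk⟩ := exists_nat_gt ‖p.2‖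
      exact absurd ((mem_iInter.1 hp k).2 : (k : ℝ) ≤ ‖p.2‖) (not_le.2 hk)
    have key := tendsto_setIntegral_of_antitone hsm hanti ⟨0, (hi 0).norm⟩
    rw [hempty, setIntegral_empty] at key
    have := ENNReal.tendsto_ofReal key
    rw [ENNReal.ofReal_zero] at this
    refine this.congr fun k => ?_
    exact ofReal_integral_norm_eq_lintegral_enorm (hi k)
  have hlim := ENNReal.Tendsto.const_mul (a := ENNReal.ofReal (n * (5 * C))) htail
    (Or.inr ENNReal.ofReal_ne_top)
  rw [mul_zero] at hlim
  have hle : ‖W b x‖ₑ ≤ 0 := by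
    refine ge_of_tendsto hlim ?_
    filter_upwards [tendsto_natCast_atTop_atTop.eventually_ge_atTop (2 * ‖x‖ + 1)] with k hk
    exact hbound k hk
  simpa using hle

lemma IsIVPSolution.restrict (hW : IsIVPSolution d t₀ T η₀ W) {t₁ : ℝ} (h : t₀ ≤ t₁)
    {η₁ : EuclideanSpace ℝ (Fin n) → ℝ}
    (hinit : ∀ K : Set (EuclideanSpace ℝ (Fin n)), IsCompact K →
      Tendsto (fun t => ∫⁻ y in K, ‖W t y - η₁ y‖ₑ) (𝓝[>] t₁) (𝓝 0)) :
    IsIVPSolution d t₁ T η₁ W where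
  contDiff_space t ht := hW.contDiff_space t ⟨h.trans_lt ht.1, ht.2⟩
  continuousOn := hW.continuousOn.mono (prod_mono (Ioo_subset_Ioo_left h) le_rfl)
  continuousOn_fderiv := hW.continuousOn_fderiv.mono (prod_mono (Ioo_subset_Ioo_left h) le_rfl)
  continuousOn_fderiv_fderiv :=
    hW.continuousOn_fderiv_fderiv.mono (prod_mono (Ioo_subset_Ioo_left h) le_rfl)
  pde t ht := hW.pde t ⟨h.trans_lt ht.1, ht.2⟩
  initial := hinit

/-- A solution with zero initial value and Gaussian growth vanishes. -/
lemma IsIVPSolution.eq_zero (hW : IsIVPSolution d t₀ T (fun _ => 0) W) (hd : ∀ i, 0 ≤ d i)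
    (hg : HasGaussianGrowth t₀ T W) {b : ℝ} (hb : b ∈ Ioo t₀ T) (x : EuclideanSpace ℝ (Fin n)) :
    W b x = 0 := by
  obtain ⟨a, -, hint⟩ := hg
  have hω0 : ∀ i, 0 ≤ √(d i) := fun i => Real.sqrt_nonneg _
  have hω : ∀ i, √(d i) ^ 2 = d i := fun i => Real.sq_sqrt (hd i)
  obtain ⟨h, hh, hk⟩ := exists_kernelBounds (fun i => √(d i)) a
  -- The length `h` depends only on the rate `a` and on `ω`, so the short-time result can be
  -- iterated.
  have hstep : ∀ k : ℕ, ∀ b ∈ Ioo t₀ T, b < t₀ + (k + 1) * (h / 2) → ∀ x, W b x = 0 := by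
    intro k
    induction k with
    | zero =>
      intro b hb hbk x
      refine hW.eq_zero_of_sub_lt hω0 hω hint hk hb ?_ x
      rw [Nat.cast_zero] at hbk
      linarith
    | succ k ih =>
      intro b hb hbk x
      push_cast at hbk
      -- Restarting `h/4` before the end of the known zero interval makes the new initial value
      -- trivially zero; the new step is shorter than `3h/4 < h`.
      set t₁ := t₀ + (k + 1) * (h / 2) - h / 4 with ht₁
      have hk0 : (0 : ℝ) ≤ k := Nat.cast_nonneg k
      have ht₀₁ : t₀ < t₁ := by rw [ht₁]; nlinarith
      rcases lt_or_ge t₁ b with hlt | hge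
      · have hW' : IsIVPSolution d t₁ T (fun _ => 0) W := hW.restrict ht₀₁.le fun K _ => by
          refine tendsto_const_nhds.congr' ?_
          have h1 : t₁ < min T (t₀ + (k + 1) * (h / 2)) :=
            lt_min (hlt.trans hb.2) (by rw [ht₁]; linarith)
          filter_upwards [Ioo_mem_nhdsGT h1] with s hs
          have h2 := ih s ⟨ht₀₁.trans hs.1, hs.2.trans_le (min_le_left _ _)⟩
            (hs.2.trans_le (min_le_right _ _))
          simp [h2]
        refine hW'.eq_zero_of_sub_lt hω0 hω
          (hint.mono_set (prod_mono (Ioo_subset_Ioo_left ht₀₁.le) le_rfl)) hk ⟨hlt, hb.2⟩ ?_ x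
        rw [ht₁]
        linarith
      · exact ih b hb (by linarith) x
  obtain ⟨k, hk'⟩ := exists_nat_gt ((b - t₀) / (h / 2))
  refine hstep k b hb ?_ x
  rw [div_lt_iff₀ (by positivity)] at hk'
  linarith

end Uniqueness

/-! ### Assembly: the solution property and differences of solutions. -/

variable {n : ℕ} {d : Fin n → ℝ} {t₀ T : ℝ} {η₀ : EuclideanSpace ℝ (Fin n) → ℝ}

lemma tendsto_sub_nhdsGT (t₀ : ℝ) : Tendsto (fun t => t - t₀) (𝓝[>] t₀) (𝓝[>] 0) := by
  refine tendsto_nhdsWithin_iff.2 ⟨?_, ?_⟩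
  · have : Tendsto (fun t : ℝ => t - t₀) (𝓝 t₀) (𝓝 (t₀ - t₀)) :=
      Continuous.tendsto (by fun_prop) t₀
    rw [sub_self] at this
    exact this.mono_left nhdsWithin_le_nhds
  · filter_upwards [self_mem_nhdsWithin] with t ht
    exact sub_pos.2 (mem_Ioi.1 ht)

/-- The action of the Mehler kernel solves the initial value problem. -/
lemma IsAdmissible.isIVPSolution (hd : ∀ i, 0 ≤ d i)
    (hη₀ : IsAdmissible (fun i => √(d i)) volume η₀) (t₀ T : ℝ) :
    IsIVPSolution d t₀ T η₀ fun t => evolve (fun i => √(d i)) volume η₀ (t - t₀) := by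
  have hU : ContDiffOn ℝ 2 (fun q : ℝ × EuclideanSpace ℝ (Fin n) =>
      evolve (fun i => √(d i)) volume η₀ (q.1 - t₀) q.2) (Ioo t₀ T ×ˢ univ) :=
    (hη₀.contDiffOn_evolve 2).comp
      (f := fun q : ℝ × EuclideanSpace ℝ (Fin n) => (q.1 - t₀, q.2))
      (ContDiff.contDiffOn (by fun_prop))
      fun q hq => ⟨show 0 < q.1 - t₀ from sub_pos.2 hq.1.1, mem_univ _⟩
  have hU1 := contDiffOn_fderiv_snd
    (U := fun t => evolve (fun i => √(d i)) volume η₀ (t - t₀)) (k := 1) isOpen_Ioo hU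
    (by norm_num)
  have hU2 := contDiffOn_fderiv_snd
    (U := fun t => fderiv ℝ (evolve (fun i => √(d i)) volume η₀ (t - t₀))) (k := 0) isOpen_Ioo hU1
    (by simp)
  refine ⟨fun t ht => contDiff_slice
    (U := fun t => evolve (fun i => √(d i)) volume η₀ (t - t₀)) hU ht, hU.continuousOn,
    hU1.continuousOn, hU2.continuousOn, fun t ht y => ?_, fun K hK => ?_⟩
  · have h := (hη₀.hasDerivAt_evolve (sub_pos.2 ht.1) y).comp t ((hasDerivAt_id t).sub_const t₀)
    simp only [Real.sq_sqrt (hd _), mul_one] at h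
    exact h
  · refine (hη₀.tendsto_setLIntegral_evolve_sub (fun i => Real.sqrt_nonneg _) hK).comp ?_
    exact tendsto_sub_nhdsGT t₀

lemma IsIVPSolution.sub {u v : ℝ → EuclideanSpace ℝ (Fin n) → ℝ} (hu : IsIVPSolution d t₀ T η₀ u)
    (hv : IsIVPSolution d t₀ T η₀ v) (hT : t₀ < T) (hη : AEStronglyMeasurable η₀) :
    IsIVPSolution d t₀ T (fun _ => 0) fun t y => u t y - v t y := by
  have hdu : ∀ t ∈ Ioo t₀ T, Differentiable ℝ (u t) := fun t ht =>
    (hu.contDiff_space t ht).differentiable two_ne_zero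
  have hdv : ∀ t ∈ Ioo t₀ T, Differentiable ℝ (v t) := fun t ht =>
    (hv.contDiff_space t ht).differentiable two_ne_zero
  have h1 : ∀ t ∈ Ioo t₀ T, fderiv ℝ (fun y => u t y - v t y) =
      fun y => fderiv ℝ (u t) y - fderiv ℝ (v t) y := fun t ht =>
    funext fun y => fderiv_fun_sub (hdu t ht y) (hdv t ht y)
  have h2 : ∀ t ∈ Ioo t₀ T, ∀ y, fderiv ℝ (fderiv ℝ (fun y => u t y - v t y)) y =
      fderiv ℝ (fderiv ℝ (u t)) y - fderiv ℝ (fderiv ℝ (v t)) y := fun t ht y => by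
    rw [h1 t ht]
    exact fderiv_fun_sub
      ((((hu.contDiff_space t ht).fderiv_right (m := 1) (by norm_num)).differentiable
        one_ne_zero) y)
      ((((hv.contDiff_space t ht).fderiv_right (m := 1) (by norm_num)).differentiable
        one_ne_zero) y)
  refine ⟨fun t ht => (hu.contDiff_space t ht).sub (hv.contDiff_space t ht),
    hu.continuousOn.sub hv.continuousOn,
    (hu.continuousOn_fderiv.sub hv.continuousOn_fderiv).congr fun p hp => ?_,
    (hu.continuousOn_fderiv_fderiv.sub hv.continuousOn_fderiv_fderiv).congr fun p hp => ?_,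
    fun t ht y => ?_, fun K hK => ?_⟩
  · exact congr_fun (h1 p.1 hp.1) p.2
  · exact h2 p.1 hp.1 p.2
  · refine ((hu.pde t ht y).sub (hv.pde t ht y)).congr_deriv ?_
    have := (hu.contDiff_space t ht).contDiffAt (x := y) |>.laplacian_sub
      ((hv.contDiff_space t ht).contDiffAt (x := y))
    change Laplacian.laplacian (fun y => u t y - v t y) y = _ at this
    rw [this]
    ring
  · have h := (hu.initial K hK).add (hv.initial K hK)
    rw [add_zero] at h
    refine tendsto_of_tendsto_of_tendsto_of_le_of_le' tendsto_const_nhds h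
      (Eventually.of_forall fun _ => zero_le) ?_
    filter_upwards [Ioo_mem_nhdsGT hT] with t ht
    have hm : AEMeasurable (fun y => ‖u t y - η₀ y‖ₑ) (volume.restrict K) :=
      ((hu.contDiff_space t ht).continuous.aestronglyMeasurable.sub hη).enorm.restrict
    rw [← lintegral_add_left' hm]
    refine lintegral_mono fun y => ?_
    have : u t y - v t y - 0 = (u t y - η₀ y) - (v t y - η₀ y) := by ring
    rw [this]
    exact enorm_sub_le

lemma HasGaussianGrowth.sub {u v : ℝ → EuclideanSpace ℝ (Fin n) → ℝ}
    (hu : HasGaussianGrowth t₀ T u) (hv : HasGaussianGrowth t₀ T v) :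
    HasGaussianGrowth t₀ T fun t y => u t y - v t y := by
  have mono : ∀ {w : ℝ → EuclideanSpace ℝ (Fin n) → ℝ} {a c : ℝ}, a ≤ c →
      IntegrableOn (fun p : ℝ × EuclideanSpace ℝ (Fin n) => Real.exp (-a * ‖p.2‖ ^ 2) * w p.1 p.2)
        (Ioo t₀ T ×ˢ univ) →
      IntegrableOn (fun p : ℝ × EuclideanSpace ℝ (Fin n) => Real.exp (-c * ‖p.2‖ ^ 2) * w p.1 p.2)
        (Ioo t₀ T ×ˢ univ) := by
    intro w a c hac hw
    refine (Integrable.bdd_mul (c := 1) hw (f := fun p : ℝ × EuclideanSpace ℝ (Fin n) =>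
      Real.exp (-(c - a) * ‖p.2‖ ^ 2)) (Continuous.aestronglyMeasurable (by fun_prop))
        (ae_of_all _ fun p => ?_)).congr (ae_of_all _ fun p => ?_)
    · rw [Real.norm_eq_abs, Real.abs_exp, Real.exp_le_one_iff]
      nlinarith [sq_nonneg ‖p.2‖]
    · beta_reduce
      rw [← mul_assoc, ← Real.exp_add]
      congr 2
      ring
  obtain ⟨a, ha, hu⟩ := hu
  obtain ⟨c, -, hv⟩ := hv
  -- The larger rate gives the smaller weight, which serves both functions.
  refine ⟨max a c, lt_max_of_lt_left ha, ?_⟩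
  refine ((mono (le_max_left a c) hu).sub (mono (le_max_right a c) hv)).congr
    (ae_of_all _ fun p => ?_)
  simp only [Pi.sub_apply]
  ring

lemma IsIVPSolution.congr {u v : ℝ → EuclideanSpace ℝ (Fin n) → ℝ}
    (hu : IsIVPSolution d t₀ T η₀ u) (h : ∀ t, t₀ < t → v t = u t) :
    IsIVPSolution d t₀ T η₀ v where
  contDiff_space t ht := by
    rw [h t ht.1]
    exact hu.contDiff_space t ht
  continuousOn := hu.continuousOn.congr fun p hp => by
    beta_reduce
    rw [h p.1 hp.1.1]
  continuousOn_fderiv := hu.continuousOn_fderiv.congr fun p hp => by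
    beta_reduce
    rw [h p.1 hp.1.1]
  continuousOn_fderiv_fderiv := hu.continuousOn_fderiv_fderiv.congr fun p hp => by
    beta_reduce
    rw [h p.1 hp.1.1]
  pde t ht y := by
    rw [h t ht.1]
    refine (hu.pde t ht y).congr_of_eventuallyEq ?_
    filter_upwards [Ioi_mem_nhds ht.1] with s hs
    rw [h s hs]
  initial K hK := (hu.initial K hK).congr' (by
    filter_upwards [self_mem_nhdsWithin] with s hs
    rw [h s hs])

end QuadraticSB

end

theorem theorem4p7 {n p : ℕ} (d : Fin n → ℝ) (hd : ∀ i, 0 ≤ d i)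
    (hp : (Finset.univ.filter fun i => d i = 0).card = p) (hpn : p < n)
    (t₀ : ℝ) (ht₀ : 0 ≤ t₀)
    (η₀ : EuclideanSpace ℝ (Fin n) → ℝ) (hη₀ : QuadraticSB.IsAdmissibleInitial d η₀)
    (η : ℝ → EuclideanSpace ℝ (Fin n) → ℝ)
    (hη : ∀ t y, η t y = ∫ z, QuadraticSB.kernelSemiPosDef d t₀ y t z * η₀ z) :
    (∀ t, t₀ < t → ∀ y : EuclideanSpace ℝ (Fin n),
      Integrable fun z => QuadraticSB.kernelSemiPosDef d t₀ y t z * η₀ z) ∧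
    (∀ T, t₀ < T →
      QuadraticSB.IsIVPSolution d t₀ T η₀ η ∧
      QuadraticSB.HasGaussianGrowth t₀ T η ∧
      ∀ u : ℝ → EuclideanSpace ℝ (Fin n) → ℝ,
        QuadraticSB.IsIVPSolution d t₀ T η₀ u → QuadraticSB.HasGaussianGrowth t₀ T u →
          ∀ t ∈ Ioo t₀ T, ∀ y, u t y = η t y) ∧
    (∀ y₀ : EuclideanSpace ℝ (Fin n), ContinuousAt η₀ y₀ →
      Tendsto (fun q : ℝ × EuclideanSpace ℝ (Fin n) => η q.1 q.2)
        (𝓝[>] t₀ ×ˢ 𝓝 y₀) (𝓝 (η₀ y₀))) := by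
  have hadm : QuadraticSB.IsAdmissible (fun i => √(d i)) volume η₀ := hη₀
  have hω : ∀ i, 0 ≤ √(d i) := fun i => Real.sqrt_nonneg _
  have hη_eq : ∀ t, t₀ < t →
      η t = QuadraticSB.evolve (fun i => √(d i)) volume η₀ (t - t₀) := fun t ht => by
    ext y
    simp_rw [hη, QuadraticSB.kernelSemiPosDef_eq d hd ht]
    rfl
  refine ⟨fun t ht y => ?_, fun T hT => ?_, fun y₀ hy₀ => ?_⟩
  · simp_rw [QuadraticSB.kernelSemiPosDef_eq d hd ht]
    exact hadm.integrable_mehlerProd_mul (sub_pos.2 ht) y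
  · have hsol : QuadraticSB.IsIVPSolution d t₀ T η₀ η :=
      (hadm.isIVPSolution hd t₀ T).congr hη_eq
    have hgrowth : QuadraticSB.HasGaussianGrowth t₀ T η := by
      refine ⟨_, QuadraticSB.gaussRate_pos hω, ?_⟩
      refine (hadm.integrableOn_exp_mul_evolve hω t₀ T).congr_fun (fun q hq => ?_)
        (measurableSet_Ioo.prod MeasurableSet.univ)
      beta_reduce
      rw [hη_eq q.1 hq.1.1]
    refine ⟨hsol, hgrowth, fun u hu hug t ht y => ?_⟩
    exact sub_eq_zero.1 ((hu.sub hsol hT hadm.aestronglyMeasurable).eq_zero hd (hug.sub hgrowth)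
      ht y)
  · have h1 : Tendsto (fun q : ℝ × EuclideanSpace ℝ (Fin n) => (q.1 - t₀, q.2))
        (𝓝[>] t₀ ×ˢ 𝓝 y₀) (𝓝[>] 0 ×ˢ 𝓝 y₀) :=
      (QuadraticSB.tendsto_sub_nhdsGT t₀).prodMap tendsto_id
    refine ((hadm.tendsto_evolve hω hy₀).comp h1).congr' ?_
    filter_upwards [prod_mem_prod self_mem_nhdsWithin univ_mem] with q hq
    exact (congr_fun (hη_eq q.1 hq.1) q.2).symm
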